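/- **Gluings.** Let $L\ge 1$, $n_1,\dots,n_L\ge 0$ be integers, and fix in advance pairwise distinct names $(i,j)$, $1\le i\le L$, $1\le j\le n_i$. A *gluing* of an $N$-gon is a word of length $N$ written along its boundary (one letter per edge) in which each name $(i,j)$ occurs exactly once and every other letter that occurs does so exactly twice; the two edges carrying the same letter are identified so that the resulting surface is orientable, and the edges with names $(i,j)$ stay unglued. The gluing *produces a surface of genus $g$ with $L$ polygonal boundaries with $n_1,\dots,n_L$ edges* if for each $i$ with $n_i>0$ the unglued edges $(i,1),\dots,(i,n_i)$ form, in this cyclic order along the boundary orientation, one boundary polygon of the resulting surface, the number of vertices on the surface that do not lie on an unglued edge (the punctured points, i.e. boundaries with $0$ edges) is $\#(n_i=0)$, and the surface has genus $g$; punctured points carry no names, i.e. are indistinguishable. Two gluings of an $N$-gon are equivalent if their words are mapped to each other by a rotation of the polygon and/or a renaming of the repeated letters. Let ${\cal N}_{g,L}(n_1,\dots,n_L)$ be the number of equivalence classes of gluings of polygons (with any number $N$ of edges) that produce a surface of genus $g$ with $L$ polygonal boundaries with $n_1,\dots,n_L$ edges; ${\cal N}_{g,L}=0$ for $g<0$.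 Put $$\tilde{\cal N}_{g,L}(n_1,\dots,n_L)=\#(n_i=0)!\;{\cal N}_{g,L}(n_1,\dots,n_L),\qquad \tilde n=n\ \text{ if } n>0,\quad \tilde n=1\ \text{ if } n=0,$$ where $\#(n_i=0)$ is the number of arguments of ${\cal N}_{g,L}$ that are equal to zero. **Lemma II.** If $g\ge 0$ and some but not all of $n_1,\dots,n_L$ are zero, then $$(L+2g-1)\,\tilde{\cal N}_{g,L}(n_1,\dots,n_L)=\sum_{1\le i<j\le L}\tilde n_i\tilde n_j\,\tilde{\cal N}_{g,L-1}(n_i+n_j+2,\,n_1,\dots,\check n_i,\dots,\check n_j,\dots,n_L)$$ $$\qquad+\frac12\sum_{i=1}^{L}\tilde n_i\sum_{x=1}^{n_i+1}\tilde{\cal N}_{g-1,L+1}(n_i+2-x,\,x,\,n_1,\dots,\check n_i,\dots,n_L),$$ where $\check n$ means that the argument is omitted. -/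

import Mathlib

open scoped BigOperators

namespace PolygonGluing

variable {ι : Type}

/-- The letters available for a gluing that produces boundary polygons with `n i` edges
(`i : ι`). The letter `Sum.inl ⟨i, j⟩` is the name, fixed in advance, of the `j`-th edge of the
`i`-th boundary; it is used for an edge that stays unglued. The letters `Sum.inr a`, with
`a : ℕ`, are the interchangeable names used for pairs of glued edges. -/
abbrev Letter (n : ι → ℕ) : Type := (Σ i : ι, Fin (n i)) ⊕ ℕ

/-- A word written along the boundary of an `N`-gon, one letter on each edge. Edge `k` runs from
corner `k` to corner `finRotate N k` (that is, `k + 1` modulo `N`). -/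
abbrev Word (n : ι → ℕ) (N : ℕ) : Type := Fin N → Letter n

namespace Word

variable {n : ι → ℕ} {N : ℕ}

/-- Every name of a boundary edge occurs exactly once, and every other letter that
occurs at all occurs exactly twice. -/
def IsSemiGaussian (w : Word n N) : Prop :=
  (∀ b : Σ i : ι, Fin (n i), ∃! k : Fin N, w k = Sum.inl b) ∧
    ∀ a : ℕ, {k : Fin N | w k = Sum.inr a}.ncard = 0 ∨ {k : Fin N | w k = Sum.inr a}.ncard = 2

/-- Two different edges of the polygon carry the same letter, and so are identified. -/
def Glued (w : Word n N) (k l : Fin N) : Prop := k ≠ l ∧ w k = w l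

/-- The identification of the corners of the polygon caused by the gluing. Glued edges are
identified with opposite directions (so that the result is orientable): the
start of edge `k` is identified with the end of edge `l`. -/
def vertexSetoid (w : Word n N) : Setoid (Fin N) :=
  Relation.EqvGen.setoid fun u v => ∃ k l : Fin N, w.Glued k l ∧ u = k ∧ v = finRotate N l

/-- The vertices of the graph which is the image of the polygon's boundary in the surface. -/
def Vertex (w : Word n N) : Type := Quotient w.vertexSetoid

/-- The vertex at which edge `k` starts. -/
def startVertex (w : Word n N) (k : Fin N) : w.Vertex := Quotient.mk w.vertexSetoid k

/-- The vertex at which edge `k` ends. -/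
def endVertex (w : Word n N) (k : Fin N) : w.Vertex :=
  Quotient.mk w.vertexSetoid (finRotate N k)

/-- On the resulting surface the unglued edges named `⟨i, 0⟩, ⟨i, 1⟩, …, ⟨i, n i - 1⟩` follow
each other in this cyclic order and close up to a polygon, for every `i`. -/
def HasPolygonalBoundaries (w : Word n N) : Prop :=
  ∀ (i : ι) (j : Fin (n i)) (k l : Fin N), w k = Sum.inl ⟨i, j⟩ →
    w l = Sum.inl ⟨i, finRotate (n i) j⟩ → w.endVertex k = w.startVertex l

/-- The punctures: the vertices that are not on any unglued edge. -/
def punctures (w : Word n N) : Set w.Vertex :=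
  {v | ∀ (k : Fin N) (b : Σ i : ι, Fin (n i)), w k = Sum.inl b →
    v ≠ w.startVertex k ∧ v ≠ w.endVertex k}

/-- The Euler characteristic of the surface obtained from the polygon (vertices minus edges plus
the one face), with punctures counted as points of the surface. The edges of the graph
correspond to the different letters of the word. -/
noncomputable def eulerChar (w : Word n N) : ℤ :=
  (Nat.card w.Vertex : ℤ) - ((Set.range w).ncard : ℤ) + 1

/-- The gluing given by `w` produces a surface of genus `g` whose boundaries are exactly polygons
with `n i` edges, `i : ι`, where the boundaries with `0` edges are the punctures. The genus is the
one of a connected compact oriented surface with boundary: Euler characteristic plus number of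
boundary circles is `2 - 2 g`. -/
def Produces [Fintype ι] (w : Word n N) (g : ℤ) : Prop :=
  w.IsSemiGaussian ∧ w.HasPolygonalBoundaries ∧
    w.punctures.ncard = (Finset.univ.filter fun i : ι => n i = 0).card ∧
    w.eulerChar + ((Finset.univ.filter fun i : ι => 0 < n i).card : ℤ) = 2 - 2 * g

/-- Two words are equivalent if a rotation of the polygon followed by a renaming of the repeated
letters maps one to the other. -/
def Equivalent (w w' : Word n N) : Prop :=
  ∃ (r : ℤ) (ρ : Equiv.Perm ℕ), ∀ k : Fin N,
    w' ((finRotate N ^ r) k) = Sum.map id ρ (w k)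

theorem equivalent_equivalence : Equivalence (Equivalent (n := n) (N := N)) where
  refl w := ⟨0, 1, fun k => by simp⟩
  symm := by
    rintro w w' ⟨r, ρ, h⟩
    refine ⟨-r, ρ⁻¹, fun k => ?_⟩
    have h1 := h ((finRotate N ^ (-r)) k)
    rw [← Equiv.Perm.mul_apply, ← zpow_add, add_neg_cancel, zpow_zero, Equiv.Perm.one_apply] at h1
    rw [h1, Sum.map_map]
    have h2 : (⇑ρ⁻¹ ∘ ⇑ρ : ℕ → ℕ) = id := by funext a; simp
    rw [h2, Function.id_comp, Sum.map_id_id, id]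
  trans := by
    rintro w w' w'' ⟨r, ρ, h⟩ ⟨s, τ, h'⟩
    refine ⟨s + r, τ * ρ, fun k => ?_⟩
    rw [zpow_add, Equiv.Perm.mul_apply, h', h, Sum.map_map]
    rfl

end Word

/-- The gluings of an `N`-gon that produce a surface of genus `g` with boundaries `n`, up to
rotation of the polygon and renaming of the repeated letters. -/
def gluingSetoid [Fintype ι] (g : ℤ) (n : ι → ℕ) (N : ℕ) :
    Setoid {w : Word n N // w.Produces g} where
  r w w' := w.1.Equivalent w'.1
  iseqv := ⟨fun w => Word.equivalent_equivalence.refl w.1,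
    fun h => Word.equivalent_equivalence.symm h,
    fun h h' => Word.equivalent_equivalence.trans h h'⟩

/-- The number of inequivalent gluings of a polygon (with any number `N` of edges) that produce a
surface of genus `g` with boundaries having `n i` edges, `i : ι`; it is `0` by convention if
`g < 0`. -/
noncomputable def numGluings [Fintype ι] (g : ℤ) (n : ι → ℕ) : ℕ :=
  if g < 0 then 0 else Nat.card (Σ N : ℕ, Quotient (gluingSetoid g n N))

/-- The rescaled number of gluings `#(n_i = 0)! * numGluings g n`. -/
noncomputable def rescaledNumGluings [Fintype ι] (g : ℤ) (n : ι → ℕ) : ℚ :=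
  ((Finset.univ.filter fun i : ι => n i = 0).card.factorial : ℚ) * (numGluings g n : ℚ)

/-- `ñ = n` if `n > 0`, and `ñ = 1` if `n = 0`. -/
def tilde (n : ℕ) : ℕ := if n = 0 then 1 else n

end PolygonGluing

/-! The proof is a double count. A gluing is replaced by a fully labelled one: a bijection `e` from
the edges of the `N`-gon to the boundary names together with `m` pairs of labels. The permutation
`boundaryPerm e`, "jump to the glued partner, then go to the next edge", runs around the vertices of
the surface. Its first-return map to the unglued edges is the cyclic order of the boundary polygons,
and its cycles that avoid the unglued edges are the punctures; `IsTrace` records both. The Euler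
characteristic then says that genus `g` with `L` boundaries means `m + 1 = L + 2 * g`
(`produces_wordOf`).

Now unglue one pair. This multiplies `boundaryPerm` by the transposition of the two freed edges
(`boundaryPerm_trans_ungluePair`). Read backwards, the return map of the unglued polygon arises from
the old one by inserting two new points and composing with the transposition that exchanges them. A
boundary with `n` edges offers `n` places for a point, and a puncture offers one, at which it ceases
to be a puncture; labelling the punctures, which is what the factorial does, turns both cases into
`tilde n` places. If the points lie on different boundaries the transposition merges two cycles into
one of length `n i + n j + 2`; if on the same one it splits a cycle into two of total length `n i +
2`. This is `labelledCount_succ`.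

Labels are removed by the group of rotations and pair-preserving relabellings. It acts freely
because some edge is unglued and hence named, and its orbits are the equivalence classes
(`rescaledNumGluings_mul`). Removing a pair keeps `N` and divides the order of this group by `2 * (m
+ 1)` (`numRelabellings_succ`). With `m + 1 = L + 2g - 1` pairs this gives the left-hand
coefficient; the 2 cancels the ordering of `(i, j)` in the merging terms and leaves the factor one
half in the splitting terms. -/

namespace PolygonGluing

/-! ### First-return maps of a permutation to marked points, and its unmarked cycles. -/

section Trace

/-- The number of isolated points created by inserting a point before `b`: one if `b = none`. -/
def noneCount {α : Type} : Option α → ℕ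
  | none => 1
  | some _ => 0

variable {X U V : Type}

/-- The classes of the relation generated by `x ∼ f x` for all `x` outside the range of `j`. -/
def chainSetoid (f : Equiv.Perm X) (j : U → X) : Setoid X :=
  Relation.EqvGen.setoid fun x y => x ∉ Set.range j ∧ y = f x

/-- The permutation `f` visits the distinguished points `j u` in the order prescribed by `μ`, and
has `P` cycles that avoid all distinguished points. -/
structure IsTrace (f : Equiv.Perm X) (j : U → X) (μ : Equiv.Perm U) (P : ℕ) : Prop where
  inj : ∀ u v, (chainSetoid f j).r (j u) (j v) → u = v
  ret : ∀ u, (chainSetoid f j).r (f (j u)) (j (μ u))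
  free : {v : Quotient (chainSetoid f j) | ∀ u, v ≠ Quotient.mk _ (j u)}.ncard = P

theorem chainSetoid_step {f : Equiv.Perm X} {j : U → X} {x : X} (hx : x ∉ Set.range j) :
    (chainSetoid f j).r x (f x) :=
  Relation.EqvGen.rel _ _ ⟨hx, rfl⟩

theorem chainSetoid_lift {β : Type} {f : Equiv.Perm X} {j : U → X} (F : X → β)
    (h : ∀ x, x ∉ Set.range j → F x = F (f x)) {x y : X} (hxy : (chainSetoid f j).r x y) :
    F x = F y := by
  induction hxy with
  | rel x y h' => rw [h'.2]; exact h _ h'.1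
  | refl => rfl
  | symm _ _ _ ih => exact ih.symm
  | trans _ _ _ _ _ ih1 ih2 => exact ih1.trans ih2

theorem chainSetoid_congr {f f' : Equiv.Perm X} {j : U → X} {j' : V → X}
    (hj : Set.range j = Set.range j') (hf : ∀ x, x ∉ Set.range j → f x = f' x) :
    chainSetoid f j = chainSetoid f' j' := by
  unfold chainSetoid
  congr 1
  funext x y
  rw [← hj]
  exact propext ⟨fun h => ⟨h.1, h.2.trans (hf x h.1)⟩, fun h => ⟨h.1, h.2.trans (hf x h.1).symm⟩⟩

/-- The class of a marked point is the arc of its cycle that ends there, and classes only use `f` at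
unmarked points. Precomposing with a transposition of marked points therefore changes the return map
alone. -/
theorem IsTrace.mul_swap [DecidableEq X] [DecidableEq U] {f : Equiv.Perm X} {j : U → X}
    {μ : Equiv.Perm U} {P : ℕ} (hj : Function.Injective j) (h : IsTrace f j μ P) (a b : U) :
    IsTrace (f * Equiv.swap (j a) (j b)) j (μ * Equiv.swap a b) P := by
  have hs : chainSetoid (f * Equiv.swap (j a) (j b)) j = chainSetoid f j := by
    refine chainSetoid_congr rfl fun x hx => ?_
    rw [Equiv.Perm.mul_apply, Equiv.swap_apply_of_ne_of_ne]
    · rintro rfl; exact hx ⟨a, rfl⟩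
    · rintro rfl; exact hx ⟨b, rfl⟩
  refine ⟨?_, ?_, ?_⟩
  · rw [hs]; exact h.inj
  · rw [hs]
    intro u
    have : Equiv.swap (j a) (j b) (j u) = j (Equiv.swap a b u) := (hj.map_swap a b u).symm
    rw [Equiv.Perm.mul_apply, Equiv.Perm.mul_apply, this]
    exact h.ret _
  · rw [hs]; exact h.free

theorem IsTrace.reparam {f : Equiv.Perm X} {j : U → X}
    {μ : Equiv.Perm U} {P : ℕ} (h : IsTrace f j μ P) (φ : V ≃ U) {ν : Equiv.Perm V}
    (hν : ∀ v, φ (ν v) = μ (φ v)) : IsTrace f (j ∘ φ) ν P := by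
  have hs : chainSetoid f (j ∘ φ) = chainSetoid f j :=
    chainSetoid_congr (by simp) fun _ _ => rfl
  refine ⟨?_, ?_, ?_⟩
  · rw [hs]; exact fun u v huv => φ.injective (h.inj _ _ huv)
  · rw [hs]
    intro u
    have := h.ret (φ u)
    rwa [← hν] at this
  · rw [hs, ← h.free]
    congr 1
    ext v
    exact φ.forall_congr_left (p := fun u => v ≠ Quotient.mk _ (j (φ u))) |>.trans (by simp)

theorem IsTrace.perm_unique {f : Equiv.Perm X} {j : U → X} {μ μ' : Equiv.Perm U} {P P' : ℕ}
    (h : IsTrace f j μ P) (h' : IsTrace f j μ' P') : μ = μ' := by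
  ext u
  exact h.inj _ _ ((chainSetoid f j).trans ((chainSetoid f j).symm (h.ret u)) (h'.ret u))

theorem IsTrace.free_unique {f : Equiv.Perm X} {j : U → X} {μ μ' : Equiv.Perm U} {P P' : ℕ}
    (h : IsTrace f j μ P) (h' : IsTrace f j μ' P') : P = P' :=
  h.free.symm.trans h'.free

/-- A marked point that returns to itself is alone on its cycle. Unmarking it adds no new
identification, and its class becomes one more free class. -/
theorem IsTrace.removeNone_of_fixed [Finite X] {f : Equiv.Perm X} {j : Option U → X}
    {μ : Equiv.Perm (Option U)} {P : ℕ} (h : IsTrace f j μ P) (hμ : μ none = none) :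
    IsTrace f (j ∘ some) (Equiv.removeNone μ) (P + 1) := by
  have hs : chainSetoid f (j ∘ some) = chainSetoid f j := by
    ext x y
    constructor
    · intro hxy
      refine Quotient.exact (s := chainSetoid f j)
        (chainSetoid_lift (fun x => Quotient.mk (chainSetoid f j) x) (fun x hx => ?_) hxy)
      apply Quotient.sound
      by_cases hx' : x = j none
      · subst hx'
        have := h.ret none
        rw [hμ] at this
        exact (chainSetoid f j).symm this
      · apply chainSetoid_step
        rintro ⟨_ | u, rfl⟩
        · exact hx' rfl
        · exact hx ⟨u, rfl⟩
    · intro hxy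
      refine Quotient.exact (s := chainSetoid f (j ∘ some))
        (chainSetoid_lift (fun x => Quotient.mk (chainSetoid f (j ∘ some)) x) (fun x hx => ?_) hxy)
      exact Quotient.sound (chainSetoid_step fun ⟨u, hu⟩ => hx ⟨some u, hu⟩)
  refine ⟨?_, ?_, ?_⟩
  · rw [hs]; exact fun u v huv => Option.some_injective _ (h.inj _ _ huv)
  · rw [hs]
    intro u
    have hu : μ (some u) ≠ none := fun h0 => by
      have := μ.injective (h0.trans hμ.symm)
      simp at this
    obtain ⟨v, hv⟩ := Option.ne_none_iff_exists'.1 hu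
    have h1 : some (Equiv.removeNone μ u) = μ (some u) := Equiv.removeNone_some μ ⟨v, hv⟩
    have := h.ret (some u)
    rw [← h1] at this
    exact this
  · rw [hs, ← h.free]
    have : {v : Quotient (chainSetoid f j) | ∀ u, v ≠ Quotient.mk _ ((j ∘ some) u)} =
        insert (Quotient.mk _ (j none))
          {v : Quotient (chainSetoid f j) | ∀ u, v ≠ Quotient.mk _ (j u)} := by
      ext v
      simp only [Set.mem_ofPred_eq, Set.mem_insert_iff, Function.comp]
      constructor
      · intro hv
        by_cases h0 : v = Quotient.mk _ (j none)
        · exact Or.inl h0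
        · refine Or.inr ?_
          rintro (_ | u)
          · exact h0
          · exact hv u
      · rintro (rfl | hv) u
        · intro h1
          have := h.inj _ _ (Quotient.exact h1)
          simp at this
        · exact hv _
    rw [this, Set.ncard_insert_of_notMem]
    simp only [Set.mem_ofPred_eq, not_forall, not_not]
    exact ⟨none, rfl⟩

/-- Unmarking a point fuses its arc with the arc of the next marked point `v`, and does nothing
else; so no free class appears. -/
theorem IsTrace.removeNone_of_moved [Finite X] {f : Equiv.Perm X} {j : Option U → X}
    {μ : Equiv.Perm (Option U)} {P : ℕ} (h : IsTrace f j μ P) {v : U} (hμ : μ none = some v) :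
    IsTrace f (j ∘ some) (Equiv.removeNone μ) P := by
  classical
  set s := chainSetoid f j with hs
  set t := chainSetoid f (j ∘ some) with ht
  have hst : ∀ {x y}, s.r x y → t.r x y := by
    intro x y hxy
    refine Quotient.exact (s := t) (chainSetoid_lift (fun x => Quotient.mk t x) (fun x hx => ?_) hxy)
    exact Quotient.sound (chainSetoid_step fun ⟨u, hu⟩ => hx ⟨some u, hu⟩)
  -- `F` collapses the class of `none` onto that of `v`. It is invariant under the coarser relation
  -- `t`, which shows that `t` makes no further identification.
  let F : X → Quotient s := fun x =>
    if Quotient.mk s x = Quotient.mk s (j none) then Quotient.mk s (j (some v)) else Quotient.mk s x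
  have hF : ∀ {x y}, t.r x y → F x = F y := by
    intro x y hxy
    refine chainSetoid_lift F (fun x hx => ?_) hxy
    by_cases hx' : x = j none
    · subst hx'
      have h1 : Quotient.mk s (f (j none)) = Quotient.mk s (j (some v)) := by
        have := h.ret none
        rw [hμ] at this
        exact Quotient.sound this
      simp only [F, h1, if_true, ite_self]
    · have h1 : Quotient.mk s (f x) = Quotient.mk s x := by
        refine (Quotient.sound (chainSetoid_step ?_)).symm
        rintro ⟨_ | u, rfl⟩
        · exact hx' rfl
        · exact hx ⟨u, rfl⟩
      simp only [F, h1]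
  have hFs : ∀ u, F (j (some u)) = Quotient.mk s (j (some u)) := by
    intro u
    refine if_neg fun h1 => ?_
    have := h.inj _ _ (Quotient.exact h1)
    simp at this
  have hk : t.r (j none) (j (some v)) := by
    have h1 : t.r (j none) (f (j none)) := by
      apply chainSetoid_step
      rintro ⟨u, hu⟩
      have := h.inj (some u) none (hu ▸ s.refl _)
      simp at this
    have h2 := h.ret none
    rw [hμ] at h2
    exact t.trans h1 (hst h2)
  refine ⟨?_, ?_, ?_⟩
  · intro u w huw
    have := hF huw
    simp only [Function.comp, hFs] at this
    exact Option.some_injective _ (h.inj _ _ (Quotient.exact this))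
  · intro u
    change t.r (f (j (some u))) (j (some (Equiv.removeNone μ u)))
    have h1 := hst (h.ret (some u))
    rcases hu : μ (some u) with _ | w
    · rw [Equiv.removeNone_none μ hu, hμ]
      rw [hu] at h1
      exact t.trans h1 hk
    · rw [Equiv.removeNone_some μ ⟨w, hu⟩]
      exact h1
  · rw [← h.free]
    symm
    refine Set.ncard_congr (fun q _ => Quotient.map' (s₂ := t) id (fun _ _ h => hst h) q) ?_ ?_ ?_
    · rintro ⟨x⟩ hx u h1
      have h1 := hF (Quotient.exact (s := t) h1)
      simp only [id, Function.comp, hFs] at h1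
      have hx1 := hx none
      have hx2 := hx (some u)
      rw [show F x = Quotient.mk s x from if_neg hx1] at h1
      exact hx2 h1
    · rintro ⟨x⟩ ⟨y⟩ hx hy h1
      have h1 := hF (Quotient.exact (s := t) h1)
      simp only [id] at h1
      rw [show F x = Quotient.mk s x from if_neg (hx none),
        show F y = Quotient.mk s y from if_neg (hy none)] at h1
      exact h1
    · rintro ⟨x⟩ hx
      refine ⟨Quotient.mk s x, ?_, rfl⟩
      rintro (_ | u) h1
      · exact hx v (Quotient.sound (s := t) (t.trans (hst (Quotient.exact h1)) hk))
      · exact hx u (Quotient.sound (s := t) (hst (Quotient.exact h1)))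

theorem IsTrace.removeNone [Finite X] {f : Equiv.Perm X} {j : Option U → X}
    {μ : Equiv.Perm (Option U)} {P : ℕ} (h : IsTrace f j μ P) :
    IsTrace f (j ∘ some) (Equiv.removeNone μ) (P + noneCount (μ none)) := by
  rcases hμ : μ none with _ | v
  · simpa [noneCount] using h.removeNone_of_fixed hμ
  · simpa [noneCount] using h.removeNone_of_moved hμ

theorem isTrace_of_equiv (f : Equiv.Perm X) (j : U ≃ X) :
    IsTrace f j ((j.trans f).trans j.symm) 0 := by
  have hr : ∀ {x y}, (chainSetoid f j).r x y → x = y := by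
    intro x y h
    exact chainSetoid_lift (fun x => x) (fun x hx => absurd (j.surjective x) hx) h
  refine ⟨fun u v h => j.injective (hr h), fun u => ?_, ?_⟩
  · simp
  · have : {v : Quotient (chainSetoid f j) | ∀ u, v ≠ Quotient.mk _ (j u)} = ∅ := by
      refine Set.eq_empty_of_forall_notMem ?_
      rintro ⟨x⟩ hx
      obtain ⟨u, rfl⟩ := j.surjective x
      exact hx u rfl
    rw [this, Set.ncard_empty]

/-- When every point is marked, the return map is `f` itself. The general case unmarks points one at
a time, by induction on the number of unmarked points. -/
theorem exists_isTrace [Finite X] (f : Equiv.Perm X) (j : U → X) (hj : Function.Injective j) :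
    ∃ μ P, IsTrace f j μ P := by
  classical
  induction hc : (Set.range j)ᶜ.ncard generalizing U with
  | zero =>
    have hs : Function.Surjective j := by
      rw [Set.ncard_eq_zero, Set.compl_empty_iff] at hc
      exact Set.range_eq_univ.1 hc
    exact ⟨_, _, isTrace_of_equiv f (Equiv.ofBijective j ⟨hj, hs⟩)⟩
  | succ c ih =>
    obtain ⟨x, hx⟩ : (Set.range j)ᶜ.Nonempty := by
      rw [← Set.ncard_pos, hc]; omega
    have hr : Set.range (fun o : Option U => o.elim x j) = insert x (Set.range j) := by
      ext y
      simp [Option.exists, eq_comm]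
    obtain ⟨μ, P, h⟩ := ih (fun o : Option U => o.elim x j) (by
      rintro (_ | u) (_ | v) h
      · rfl
      · exact absurd ⟨v, h.symm⟩ hx
      · exact absurd ⟨u, h⟩ hx
      · exact congrArg some (hj h)) (by
      rw [hr, Set.insert_eq, Set.compl_union, Set.inter_comm, ← Set.sdiff_eq,
        Set.ncard_sdiff_singleton_of_mem hx, hc, Nat.add_sub_cancel])
    exact ⟨_, _, h.removeNone⟩

end Trace

/-! ### Labelled gluings, and the effect of ungluing one pair. -/

section LabelledGluing

/-- The involution on labels that exchanges the two labels of each glued pair and fixes the names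
of the unglued edges. -/
def flipPair (U : Type) (m : ℕ) : Equiv.Perm (U ⊕ Fin m × Bool) :=
  Equiv.sumCongr (Equiv.refl U) (Equiv.prodCongr (Equiv.refl (Fin m)) Equiv.boolNot)

@[simp] theorem flipPair_inl {U : Type} {m : ℕ} (u : U) :
    flipPair U m (Sum.inl u) = Sum.inl u := rfl

@[simp] theorem flipPair_inr {U : Type} {m : ℕ} (a : Fin m) (b : Bool) :
    flipPair U m (Sum.inr (a, b)) = Sum.inr (a, !b) := rfl

/-- The permutation of the edges of an `N`-gon with glued pairs given by the labelling `e`, whose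
cycles run along the boundaries of the glued surface. -/
def boundaryPerm {N m : ℕ} {U : Type} (e : Fin N ≃ U ⊕ Fin m × Bool) : Equiv.Perm (Fin N) :=
  finRotate N * (e.trans (flipPair U m)).trans e.symm

/-- Labellings of the edges of an `N`-gon by the elements of `U` (unglued edges) and `m` glued
pairs, for which the unglued edges follow each other along the boundaries as prescribed by `ν` and
there are `P` punctures. -/
def LabelledGluing (N m : ℕ) {U : Type} (ν : Equiv.Perm U) (P : ℕ) : Type :=
  {e : Fin N ≃ U ⊕ Fin m × Bool // IsTrace (boundaryPerm e) (e.symm ∘ Sum.inl) ν P}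

/-- Ungluing the first pair: its two labels become the names of two additional unglued edges. -/
def ungluePair (U : Type) (m : ℕ) :
    U ⊕ Fin (m + 1) × Bool ≃ Option (Option U) ⊕ Fin m × Bool where
  toFun := Sum.elim (fun u => Sum.inl (some (some u)))
    fun p => Fin.cases (motive := fun _ => Option (Option U) ⊕ Fin m × Bool)
      (Sum.inl (if p.2 then none else some none)) (fun a => Sum.inr (a, p.2)) p.1
  invFun := Sum.elim
    (fun o => o.elim (Sum.inr (0, true)) fun o => o.elim (Sum.inr (0, false)) Sum.inl)
    fun p => Sum.inr (p.1.succ, p.2)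
  left_inv := by
    rintro (u | ⟨a, b⟩)
    · rfl
    · refine Fin.cases ?_ (fun a => ?_) a
      · cases b <;> rfl
      · rfl
  right_inv := by
    rintro ((_ | _ | u) | ⟨a, b⟩) <;> simp

theorem ungluePair_flipPair {U : Type} [DecidableEq U] (m : ℕ) (x : U ⊕ Fin (m + 1) × Bool) :
    ungluePair U m (flipPair U (m + 1) x) = flipPair (Option (Option U)) m
      (Equiv.swap (Sum.inl none) (Sum.inl (some none)) (ungluePair U m x)) := by
  rcases x with u | ⟨a, b⟩
  · rw [Equiv.swap_apply_of_ne_of_ne] <;> simp [ungluePair]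
  · refine Fin.cases ?_ (fun a => ?_) a
    · cases b <;> simp [ungluePair, flipPair]
    · rw [Equiv.swap_apply_of_ne_of_ne] <;> simp [ungluePair]

/-- Only the two edges of the first pair change partner when it is unglued: each becomes its own
partner. The flips before and after thus differ by one transposition. -/
theorem boundaryPerm_trans_ungluePair {N m : ℕ} {U : Type} [DecidableEq U]
    (e : Fin N ≃ U ⊕ Fin (m + 1) × Bool) :
    boundaryPerm e = boundaryPerm (e.trans (ungluePair U m)) *
      Equiv.swap ((e.trans (ungluePair U m)).symm (Sum.inl none))
        ((e.trans (ungluePair U m)).symm (Sum.inl (some none))) := by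
  ext k : 1
  simp only [boundaryPerm, Equiv.Perm.mul_apply, Equiv.trans_apply]
  congr 1
  apply (e.trans (ungluePair U m)).injective
  rw [Equiv.apply_symm_apply, Equiv.trans_apply, Equiv.apply_symm_apply, ungluePair_flipPair,
    ← Equiv.trans_apply e (ungluePair U m) (Equiv.swap _ _ _),
    (e.trans (ungluePair U m)).injective.map_swap, Equiv.apply_symm_apply, Equiv.apply_symm_apply,
    Equiv.trans_apply]

/-- The permutation of `Option U` obtained from `ν` by inserting `none` into a cycle, just before
the element `b`, or as a fixed point if `b = none`. -/
def insertNone {U : Type} [DecidableEq U] (b : Option U) (ν : Equiv.Perm U) :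
    Equiv.Perm (Option U) :=
  Equiv.swap none b * ν.optionCongr

theorem insertNone_none {U : Type} [DecidableEq U] (b : Option U) (ν : Equiv.Perm U) :
    insertNone b ν none = b := by simp [insertNone]

theorem removeNone_insertNone {U : Type} [DecidableEq U] (b : Option U) (ν : Equiv.Perm U) :
    Equiv.removeNone (insertNone b ν) = ν :=
  congrArg Prod.snd (Equiv.Perm.decomposeOption.right_inv (b, ν))

theorem eq_insertNone {U : Type} [DecidableEq U] (μ : Equiv.Perm (Option U)) :
    μ = insertNone (μ none) (Equiv.removeNone μ) :=
  (Equiv.Perm.decomposeOption.left_inv μ).symm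

theorem natCard_subtype_eq_sum {α κ : Type} [Finite α] [Fintype κ] (R : α → Prop)
    (Q : κ → α → Prop) (hR : ∀ x, R x ↔ ∃ p, Q p x) (hQ : ∀ x p q, Q p x → Q q x → p = q) :
    Nat.card {x // R x} = ∑ p, Nat.card {x // Q p x} := by
  rw [← Nat.card_sigma]
  symm
  refine Nat.card_congr (Equiv.ofBijective
    (fun s : Σ p, {x // Q p x} => (⟨s.2.1, (hR _).2 ⟨s.1, s.2.2⟩⟩ : {x // R x})) ⟨?_, ?_⟩)
  · rintro ⟨p, x, hx⟩ ⟨q, y, hy⟩ h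
    obtain rfl : x = y := congrArg Subtype.val h
    obtain rfl := hQ _ _ _ hx hy
    rfl
  · rintro ⟨x, hx⟩
    obtain ⟨p, hp⟩ := (hR x).1 hx
    exact ⟨⟨p, x, hp⟩, rfl⟩

/-- Keep the two extra points marked and take the full return map `μ` of the product. Forgetting
them yields `ν`, so `μ` is `ν` with two points inserted, and `mul_swap` removes the transposition. A
point inserted as a fixed point accounts for one of the `P` free cycles. -/
theorem isTrace_iff_exists_insertNone {X U : Type} [Finite X] [DecidableEq X] [DecidableEq U]
    {f : Equiv.Perm X} {j : Option (Option U) → X} (hj : Function.Injective j)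
    {ν : Equiv.Perm U} {P : ℕ} :
    IsTrace (f * Equiv.swap (j none) (j (some none))) (j ∘ some ∘ some) ν P ↔
      ∃ p : Option U × Option (Option U), ∃ P',
        P' + noneCount p.1 + noneCount p.2 = P ∧
        IsTrace f j (insertNone p.2 (insertNone p.1 ν) * Equiv.swap none (some none)) P' := by
  constructor
  · intro h
    obtain ⟨μ, P', h'⟩ := exists_isTrace (f * Equiv.swap (j none) (j (some none))) j hj
    have h1 := h'.removeNone.removeNone
    refine ⟨(Equiv.removeNone μ none, μ none), P', ?_, ?_⟩
    · rw [← h1.free_unique h]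
      exact add_right_comm _ _ _
    · rw [← h1.perm_unique h, ← eq_insertNone, ← eq_insertNone]
      have := h'.mul_swap hj none (some none)
      rwa [mul_assoc, Equiv.swap_mul_self, mul_one] at this
  · rintro ⟨⟨b, a⟩, P', rfl, h⟩
    have h1 := (h.mul_swap hj none (some none))
    rw [mul_assoc (insertNone _ _), Equiv.swap_mul_self, mul_one] at h1
    have h2 := h1.removeNone.removeNone
    rw [insertNone_none, removeNone_insertNone, insertNone_none, removeNone_insertNone] at h2
    rw [add_right_comm]
    exact h2

instance {N m : ℕ} {U : Type} {ν : Equiv.Perm U} {P : ℕ} : Finite (LabelledGluing N m ν P) := by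
  unfold LabelledGluing
  rcases isEmpty_or_nonempty (Fin N ≃ U ⊕ Fin m × Bool) with h | ⟨⟨e⟩⟩
  · infer_instance
  · have : Finite (U ⊕ Fin m × Bool) := Finite.of_equiv _ e
    infer_instance

/-- The gluings are sorted by the places `b` and `a` at which the two freed edges enter the return
map. The condition guards the truncated subtraction. -/
theorem natCard_labelledGluing_succ (N m : ℕ) {U : Type} [Fintype U] [DecidableEq U]
    (ν : Equiv.Perm U) (P : ℕ) :
    Nat.card (LabelledGluing N (m + 1) ν P) = ∑ b : Option U, ∑ a : Option (Option U),
      if noneCount b + noneCount a ≤ P then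
        Nat.card (LabelledGluing N m (insertNone a (insertNone b ν) * Equiv.swap none (some none))
          (P - (noneCount b + noneCount a)))
      else 0 := by
  have key : ∀ e : Fin N ≃ U ⊕ Fin (m + 1) × Bool,
      IsTrace (boundaryPerm e) (e.symm ∘ Sum.inl) ν P ↔
      IsTrace (boundaryPerm (e.trans (ungluePair U m)) *
        Equiv.swap (((e.trans (ungluePair U m)).symm ∘ Sum.inl) none)
          (((e.trans (ungluePair U m)).symm ∘ Sum.inl) (some none)))
        (((e.trans (ungluePair U m)).symm ∘ Sum.inl) ∘ some ∘ some) ν P := by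
    intro e
    rw [boundaryPerm_trans_ungluePair]
    rfl
  have h1 : Nat.card (LabelledGluing N (m + 1) ν P) =
      Nat.card {e : Fin N ≃ Option (Option U) ⊕ Fin m × Bool //
        IsTrace (boundaryPerm e * Equiv.swap ((e.symm ∘ Sum.inl) none)
          ((e.symm ∘ Sum.inl) (some none))) ((e.symm ∘ Sum.inl) ∘ some ∘ some) ν P} :=
    Nat.card_congr (Equiv.subtypeEquiv
      (Equiv.equivCongr (Equiv.refl _) (ungluePair U m)) fun e => key e)
  rw [h1, natCard_subtype_eq_sum _ (fun (p : Option U × Option (Option U)) e =>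
    ∃ P', P' + noneCount p.1 + noneCount p.2 = P ∧
      IsTrace (boundaryPerm e) (e.symm ∘ Sum.inl)
        (insertNone p.2 (insertNone p.1 ν) * Equiv.swap none (some none)) P')
    (fun e => isTrace_iff_exists_insertNone (e.symm.injective.comp Sum.inl_injective))
    ?_, Fintype.sum_prod_type]
  · refine Finset.sum_congr rfl fun b _ => Finset.sum_congr rfl fun a _ => ?_
    split_ifs with h
    · refine Nat.card_congr (Equiv.subtypeEquivRight fun e => ?_)
      constructor
      · rintro ⟨P', h2, h3⟩
        rwa [← h2, add_assoc, Nat.add_sub_cancel]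
      · intro h3
        exact ⟨_, by rw [add_assoc, Nat.sub_add_cancel h], h3⟩
    · rw [Nat.card_eq_zero]
      left
      refine ⟨?_⟩
      rintro ⟨e, P', h2, -⟩
      apply h
      simp only at h2
      omega
  -- The places are determined by `e`: return maps are unique, and an insertion place is read off as
  -- the image of `none`.
  · rintro e ⟨b, a⟩ ⟨b', a'⟩ ⟨P', -, h⟩ ⟨P'', -, h'⟩
    have h2 := mul_right_cancel (h.perm_unique h')
    have h3 : a = a' := by
      have := congrArg (fun μ : Equiv.Perm _ => μ none) h2
      simpa only [insertNone_none] using this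
    have h4 := congrArg Equiv.removeNone h2
    simp only [removeNone_insertNone] at h4
    have h5 : b = b' := by
      have := congrArg (fun μ : Equiv.Perm _ => μ none) h4
      simpa only [insertNone_none] using this
    rw [h3, h5]

theorem natCard_labelledGluing_congr (N m : ℕ) {U V : Type} {μ : Equiv.Perm U} {ν : Equiv.Perm V}
    (φ : V ≃ U) (hφ : ∀ v, φ (ν v) = μ (φ v)) (P : ℕ) :
    Nat.card (LabelledGluing N m μ P) = Nat.card (LabelledGluing N m ν P) := by
  have hφ' : ∀ u, φ.symm (μ u) = ν (φ.symm u) := fun u => by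
    rw [Equiv.symm_apply_eq, hφ, Equiv.apply_symm_apply]
  have hb : ∀ e : Fin N ≃ U ⊕ Fin m × Bool,
      boundaryPerm (e.trans (Equiv.sumCongr φ.symm (Equiv.refl _))) = boundaryPerm e := by
    intro e
    unfold boundaryPerm
    congr 1
    ext k : 1
    apply (e.trans (Equiv.sumCongr φ.symm (Equiv.refl _))).injective
    simp only [Equiv.trans_apply, Equiv.apply_symm_apply]
    rcases e k with u | p
    · rfl
    · rfl
  refine Nat.card_congr (Equiv.subtypeEquiv
    (Equiv.equivCongr (Equiv.refl _) (Equiv.sumCongr φ.symm (Equiv.refl _))) fun e => ?_)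
  change IsTrace _ _ _ _ ↔ IsTrace
    (boundaryPerm (e.trans (Equiv.sumCongr φ.symm (Equiv.refl _)))) _ _ _
  rw [hb]
  constructor
  · intro h
    exact h.reparam φ hφ
  · intro h
    have := h.reparam φ.symm hφ'
    convert this using 1
    ext u : 1
    exact congrArg (fun v => e.symm (Sum.inl v)) (φ.apply_symm_apply u).symm

end LabelledGluing

/-! ### Explicit coordinates on cycles, and how insertion, merging and splitting act on them. -/

section CycleParam

variable {ι U : Type}

/-- The functions `φ i` on `{0, …, n i - 1}` parametrize the cycles of `σ`. -/
structure IsCycleParam (σ : Equiv.Perm U) (n : ι → ℕ) (φ : ι → ℕ → U) : Prop where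
  step : ∀ i t, t + 1 < n i → σ (φ i t) = φ i (t + 1)
  wrap : ∀ i t, t + 1 = n i → σ (φ i t) = φ i 0
  inj : ∀ i t i' t', t < n i → t' < n i' → φ i t = φ i' t' → i = i' ∧ t = t'
  surj : ∀ u, ∃ i t, t < n i ∧ φ i t = u

/-- The permutation of the names of the boundary edges that sends each one to the next one on the
same boundary polygon. -/
def nextEdge (n : ι → ℕ) : Equiv.Perm (Σ i, Fin (n i)) :=
  Equiv.sigmaCongrRight fun i => finRotate (n i)

theorem finRotate_mk_of_lt {n t : ℕ} (h : t + 1 < n) (h' : t < n) :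
    finRotate n ⟨t, h'⟩ = ⟨t + 1, h⟩ := by
  obtain ⟨k, rfl⟩ : ∃ k, n = k + 1 := ⟨n - 1, by omega⟩
  exact finRotate_of_lt (by omega)

theorem finRotate_mk_of_eq {n t : ℕ} (h : t + 1 = n) (h' : t < n) (h0 : 0 < n) :
    finRotate n ⟨t, h'⟩ = ⟨0, h0⟩ := by
  subst h
  exact finRotate_last'

theorem exists_isCycleParam_nextEdge (n : ι → ℕ) [Nonempty (Σ i, Fin (n i))] :
    ∃ φ, IsCycleParam (nextEdge n) n φ := by
  classical
  -- Filler for positions beyond the length of a cycle; the conditions never look there.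
  let d : Σ i, Fin (n i) := Classical.arbitrary _
  refine ⟨fun i t => if h : t < n i then ⟨i, t, h⟩ else d, ?_, ?_, ?_, ?_⟩
  · intro i t h
    simp only [dif_pos h, dif_pos (show t < n i by omega)]
    exact congrArg (Sigma.mk i) (finRotate_mk_of_lt h _)
  · intro i t h
    simp only [dif_pos (show t < n i by omega), dif_pos (show 0 < n i by omega)]
    exact congrArg (Sigma.mk i) (finRotate_mk_of_eq h _ _)
  · intro i t i' t' h h' heq
    simp only [dif_pos h, dif_pos h'] at heq
    cases heq
    exact ⟨rfl, rfl⟩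
  · rintro ⟨i, t, h⟩
    exact ⟨i, t, h, dif_pos h⟩

/-- The bijection between edge names and elements of `U` given by a parametrization of cycles. -/
noncomputable def IsCycleParam.equiv {σ : Equiv.Perm U} {n : ι → ℕ} {φ : ι → ℕ → U}
    (h : IsCycleParam σ n φ) : (Σ i, Fin (n i)) ≃ U :=
  Equiv.ofBijective (fun p => φ p.1 p.2.1) ⟨by
    rintro ⟨i, t, ht⟩ ⟨i', t', ht'⟩ heq
    obtain ⟨rfl, rfl⟩ := h.inj _ _ _ _ ht ht' heq
    rfl, fun u => by
    obtain ⟨i, t, ht, rfl⟩ := h.surj u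
    exact ⟨⟨i, t, ht⟩, rfl⟩⟩

@[simp] theorem IsCycleParam.equiv_apply {σ : Equiv.Perm U} {n : ι → ℕ} {φ : ι → ℕ → U}
    (h : IsCycleParam σ n φ) (p : Σ i, Fin (n i)) : h.equiv p = φ p.1 p.2.1 := rfl

theorem IsCycleParam.equiv_nextEdge {σ : Equiv.Perm U} {n : ι → ℕ} {φ : ι → ℕ → U}
    (h : IsCycleParam σ n φ) (p : Σ i, Fin (n i)) : h.equiv (nextEdge n p) = σ (h.equiv p) := by
  obtain ⟨i, t, ht⟩ := p
  rcases Nat.lt_or_ge (t + 1) (n i) with h1 | h1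
  · have : nextEdge n ⟨i, t, ht⟩ = ⟨i, t + 1, h1⟩ := congrArg (Sigma.mk i) (finRotate_mk_of_lt h1 _)
    rw [this]
    exact (h.step i t h1).symm
  · have h2 : t + 1 = n i := by omega
    have : nextEdge n ⟨i, t, ht⟩ = ⟨i, 0, by omega⟩ :=
      congrArg (Sigma.mk i) (finRotate_mk_of_eq h2 _ _)
    rw [this]
    exact (h.wrap i t h2).symm

theorem IsCycleParam.natCard_labelledGluing {σ : Equiv.Perm U} {n : ι → ℕ} {φ : ι → ℕ → U}
    (h : IsCycleParam σ n φ) (N m P : ℕ) :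
    Nat.card (LabelledGluing N m σ P) = Nat.card (LabelledGluing N m (nextEdge n) P) :=
  natCard_labelledGluing_congr N m h.equiv h.equiv_nextEdge P

variable [DecidableEq ι]

/-- Moving the origin of a cycle to position `x` reduces insertion at an arbitrary place to
insertion just before the origin. -/
theorem IsCycleParam.rotate {σ : Equiv.Perm U} {n : ι → ℕ} {φ : ι → ℕ → U}
    (h : IsCycleParam σ n φ) (i : ι) (x : ℕ) :
    IsCycleParam σ n (fun k t => if k = i then φ i ((t + x) % n i) else φ k t) := by
  have hσ : ∀ t, t < n i → σ (φ i t) = φ i ((t + 1) % n i) := by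
    intro t ht
    rcases Nat.lt_or_ge (t + 1) (n i) with h1 | h1
    · rw [h.step i t h1, Nat.mod_eq_of_lt h1]
    · have h2 : t + 1 = n i := by omega
      rw [h.wrap i t h2, h2, Nat.mod_self]
  refine ⟨?_, ?_, ?_, ?_⟩
  · intro k t hk
    split_ifs with hki
    · subst hki
      rw [hσ _ (Nat.mod_lt _ (by omega)), Nat.mod_add_mod]
      congr 2
      ring
    · exact h.step k t hk
  · intro k t hk
    split_ifs with hki
    · subst hki
      rw [hσ _ (Nat.mod_lt _ (by omega)), Nat.mod_add_mod]
      rw [add_right_comm, hk, Nat.add_mod_left, zero_add]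
    · exact h.wrap k t hk
  · intro k t k' t' hk hk' heq
    split_ifs at heq with h1 h2 h2
    · subst h1 h2
      refine ⟨rfl, ?_⟩
      have h3 := (h.inj _ _ _ _ (Nat.mod_lt _ (by omega)) (Nat.mod_lt _ (by omega)) heq).2
      have h4 := Nat.ModEq.add_right_cancel' x h3
      exact Nat.ModEq.eq_of_lt_of_lt h4 hk hk'
    · subst h1
      exact absurd (h.inj _ _ _ _ (Nat.mod_lt _ (by omega)) hk' heq).1.symm h2
    · subst h2
      exact absurd (h.inj _ _ _ _ hk (Nat.mod_lt _ (by omega)) heq).1 h1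
    · exact h.inj _ _ _ _ hk hk' heq
  · intro u
    obtain ⟨k, t, ht, rfl⟩ := h.surj u
    by_cases hk : k = i
    · subst hk
      have hpos : 0 < n k := by omega
      -- The witness is `t - x` modulo `n k`, written so that the subtraction does not truncate.
      refine ⟨k, (t + (n k - x % n k)) % n k, Nat.mod_lt _ hpos, ?_⟩
      simp only [if_true]
      congr 1
      have hx := Nat.mod_lt x hpos
      rw [Nat.mod_add_mod]
      conv_lhs => rw [← Nat.div_add_mod x (n k)]
      have : t + (n k - (n k * (x / n k) + x % n k) % n k) + (n k * (x / n k) + x % n k) =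
          t + n k * (x / n k + 1) := by
        rw [Nat.mul_add_mod, Nat.mod_mod, mul_add]
        omega
      rw [this, Nat.add_mul_mod_self_left, Nat.mod_eq_of_lt ht]
    · exact ⟨k, t, ht, by simp [hk]⟩

variable [DecidableEq U]

theorem insertNone_some_eq_none {σ : Equiv.Perm U} (u : U) :
    insertNone (some (σ u)) σ (some u) = none := by
  simp [insertNone]

theorem insertNone_some_of_ne {σ : Equiv.Perm U} {b : Option U} {u : U} (h : b ≠ some (σ u)) :
    insertNone b σ (some u) = some (σ u) := by
  simp only [insertNone, Equiv.Perm.mul_apply, Equiv.optionCongr_apply, Option.map_some]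
  exact Equiv.swap_apply_of_ne_of_ne (by simp) h.symm

/-- A point inserted before the origin is the last one on its cycle, so the old coordinates survive.
An empty cycle becomes a fixed point. -/
theorem IsCycleParam.insertNone {σ : Equiv.Perm U} {n : ι → ℕ} {φ : ι → ℕ → U}
    (h : IsCycleParam σ n φ) (i : ι) {b : Option U}
    (hb : b = if n i = 0 then none else some (φ i 0)) :
    IsCycleParam (insertNone b σ) (Function.update n i (n i + 1))
      (fun k t => if k = i ∧ t = n i then none else some (φ k t)) := by
  have hn : ∀ k, k ≠ i → Function.update n i (n i + 1) k = n k :=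
    fun k hk => Function.update_of_ne hk _ _
  refine ⟨?_, ?_, ?_, ?_⟩
  · intro k t hk
    by_cases hki : k = i
    · subst hki
      rw [Function.update_self] at hk
      rw [if_neg (by omega)]
      by_cases h1 : t + 1 = n k
      · rw [if_pos ⟨rfl, h1⟩, hb, if_neg (by omega), ← h.wrap k t h1, insertNone_some_eq_none]
      · rw [if_neg (by omega), insertNone_some_of_ne, h.step k t (by omega)]
        rw [hb, if_neg (by omega), h.step k t (by omega)]
        intro h2
        have := (h.inj _ _ _ _ (by omega) (by omega) (Option.some_injective _ h2)).2
        omega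
    · rw [hn k hki] at hk
      rw [if_neg (by tauto), if_neg (by tauto), insertNone_some_of_ne, h.step k t hk]
      rw [hb, h.step k t hk]
      split_ifs with h1
      · simp
      · intro h2
        exact hki (h.inj _ _ _ _ (by omega) hk (Option.some_injective _ h2)).1.symm
  · intro k t hk
    by_cases hki : k = i
    · subst hki
      rw [Function.update_self] at hk
      rw [if_pos ⟨rfl, by omega⟩, insertNone_none, hb]
      split_ifs with h1 h2 h3
      · rfl
      · exact absurd h1.symm (by tauto)
      · exact absurd h3.2.symm h1
      · rfl
    · rw [hn k hki] at hk
      rw [if_neg (by tauto), if_neg (by tauto), insertNone_some_of_ne, h.wrap k t hk]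
      rw [hb, h.wrap k t hk]
      split_ifs with h1
      · simp
      · intro h2
        exact hki (h.inj _ _ _ _ (by omega) (by omega) (Option.some_injective _ h2)).1.symm
  · intro k t k' t' hk hk' heq
    have h1 : ∀ k t, t < Function.update n i (n i + 1) k → ¬ (k = i ∧ t = n i) → t < n k := by
      intro k t hk hkt
      by_cases hki : k = i
      · subst hki
        rw [Function.update_self] at hk
        have : t ≠ n k := fun h => hkt ⟨rfl, h⟩
        omega
      · rwa [hn k hki] at hk
    split_ifs at heq with h2 h3 h3
    · exact ⟨h2.1.trans h3.1.symm, h2.2.trans h3.2.symm⟩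
    · exact h.inj _ _ _ _ (h1 _ _ hk h2) (h1 _ _ hk' h3) (Option.some_injective _ heq)
  · rintro (_ | u)
    · exact ⟨i, n i, by simp, by simp⟩
    · obtain ⟨k, t, ht, rfl⟩ := h.surj u
      refine ⟨k, t, ?_, if_neg ?_⟩
      · by_cases hki : k = i
        · subst hki
          rw [Function.update_self]
          omega
        · rwa [hn k hki]
      · rintro ⟨rfl, rfl⟩
        omega

/-- The boundary lengths after boundaries `i` and `j` have been merged into one with `s` edges. -/
def mergeLengths (n : ι → ℕ) (i j : ι) (s : ℕ) : Fin 1 ⊕ {k : ι // k ≠ i ∧ k ≠ j} → ℕ :=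
  Sum.elim ![s] (fun k => n k)

/-- The boundary lengths after boundary `i` has been split into two with `s` and `t` edges. -/
def splitLengths (n : ι → ℕ) (i : ι) (s t : ℕ) : Fin 2 ⊕ {k : ι // k ≠ i} → ℕ :=
  Sum.elim ![s, t] (fun k => n k)

/-- Exchanging the last points of two cycles makes the end of each lead to the start of the other,
so the cycles are concatenated. -/
theorem IsCycleParam.merge {σ : Equiv.Perm U} {n : ι → ℕ} {φ : ι → ℕ → U}
    (h : IsCycleParam σ n φ) {i j : ι} (hij : i ≠ j) {p q : ℕ} (hp : n i = p + 1)
    (hq : n j = q + 1) :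
    IsCycleParam (σ * Equiv.swap (φ i p) (φ j q)) (mergeLengths n i j (p + q + 2))
      (Sum.elim (fun _ t => if t ≤ p then φ i t else φ j (t - (p + 1))) (fun k => φ k)) := by
  have hne : ∀ k t, t < n k → (k = i → t ≠ p) → (k = j → t ≠ q) →
      (σ * Equiv.swap (φ i p) (φ j q)) (φ k t) = σ (φ k t) := by
    intro k t hk h1 h2
    rw [Equiv.Perm.mul_apply, Equiv.swap_apply_of_ne_of_ne]
    · intro heq
      obtain ⟨rfl, rfl⟩ := h.inj _ _ _ _ hk (by omega) heq
      exact h1 rfl rfl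
    · intro heq
      obtain ⟨rfl, rfl⟩ := h.inj _ _ _ _ hk (by omega) heq
      exact h2 rfl rfl
  refine ⟨?_, ?_, ?_, ?_⟩
  · rintro (a | ⟨k, hk1, hk2⟩) t hk
    · replace hk : t + 1 < p + q + 2 := by
        rw [Subsingleton.elim a 0] at hk
        exact hk
      simp only [Sum.elim_inl]
      rcases lt_trichotomy t p with h1 | h1 | h1
      · rw [if_pos h1.le, if_pos (by omega), hne i t (by omega) (fun _ => by omega)
          (fun h => absurd h hij), h.step i t (by omega)]
      · subst h1
        rw [if_pos le_rfl, if_neg (by omega), Equiv.Perm.mul_apply, Equiv.swap_apply_left,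
          h.wrap j q hq.symm, Nat.sub_self]
      · rw [if_neg (by omega), if_neg (by omega), hne j _ (by omega) (fun h => absurd h hij.symm)
          (fun _ => by omega), h.step j _ (by omega)]
        congr 1
        omega
    · simp only [Sum.elim_inr]
      replace hk : t + 1 < n k := hk
      rw [hne k t (by omega) (fun h => absurd h hk1) (fun h => absurd h hk2), h.step k t hk]
  · rintro (a | ⟨k, hk1, hk2⟩) t hk
    · replace hk : t + 1 = p + q + 2 := by
        rw [Subsingleton.elim a 0] at hk
        exact hk
      simp only [Sum.elim_inl]
      rw [if_neg (by omega), if_pos (by omega), show t - (p + 1) = q by omega,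
        Equiv.Perm.mul_apply, Equiv.swap_apply_right, h.wrap i p hp.symm]
    · simp only [Sum.elim_inr]
      replace hk : t + 1 = n k := hk
      rw [hne k t (by omega) (fun h => absurd h hk1) (fun h => absurd h hk2), h.wrap k t hk]
  · have key : ∀ (a : Fin 1) (t : ℕ) (k : {k : ι // k ≠ i ∧ k ≠ j}) (t' : ℕ),
        t < p + q + 2 → t' < n k → (if t ≤ p then φ i t else φ j (t - (p + 1))) ≠ φ k t' := by
      rintro a t ⟨k, hk1, hk2⟩ t' ht ht' heq
      split_ifs at heq with h1
      · exact hk1 (h.inj _ _ _ _ (by omega) ht' heq).1.symm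
      · exact hk2 (h.inj _ _ _ _ (by omega) ht' heq).1.symm
    rintro (a | k) t (a' | k') t' ht ht' heq
    · obtain rfl := Subsingleton.elim a a'
      rw [Subsingleton.elim a 0] at ht ht'
      replace ht : t < p + q + 2 := ht
      replace ht' : t' < p + q + 2 := ht'
      refine ⟨rfl, ?_⟩
      simp only [Sum.elim_inl] at heq
      split_ifs at heq with h1 h2 h2
      · exact (h.inj _ _ _ _ (by omega) (by omega) heq).2
      · exact absurd (h.inj _ _ _ _ (by omega) (by omega) heq).1 hij
      · exact absurd (h.inj _ _ _ _ (by omega) (by omega) heq).1 hij.symm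
      · have := (h.inj _ _ _ _ (by omega) (by omega) heq).2
        omega
    · rw [Subsingleton.elim a 0] at ht
      exact absurd heq (key 0 t k' t' ht ht')
    · rw [Subsingleton.elim a' 0] at ht'
      exact absurd heq.symm (key 0 t' k t ht' ht)
    · obtain ⟨h1, h2⟩ := h.inj _ _ _ _ ht ht' heq
      exact ⟨congrArg Sum.inr (Subtype.ext h1), h2⟩
  · intro u
    obtain ⟨k, t, ht, rfl⟩ := h.surj u
    by_cases hki : k = i
    · subst hki
      refine ⟨Sum.inl 0, t, ?_, if_pos (by omega)⟩
      change t < p + q + 2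
      omega
    by_cases hkj : k = j
    · subst hkj
      refine ⟨Sum.inl 0, p + 1 + t, ?_, ?_⟩
      · change p + 1 + t < p + q + 2
        omega
      · simp only [Sum.elim_inl]
        rw [if_neg (by omega), Nat.add_sub_cancel_left]
    · exact ⟨Sum.inr ⟨k, hki, hkj⟩, t, ht, rfl⟩

/-- Exchanging the last point with the one at `p` closes up positions `0, …, p` and `p + 1, …, p + q
+ 1` separately. -/
theorem IsCycleParam.split {σ : Equiv.Perm U} {n : ι → ℕ} {φ : ι → ℕ → U}
    (h : IsCycleParam σ n φ) {i : ι} {p q : ℕ} (hpq : n i = p + q + 2) :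
    IsCycleParam (σ * Equiv.swap (φ i (p + q + 1)) (φ i p)) (splitLengths n i (q + 1) (p + 1))
      (Sum.elim ![fun t => φ i (p + 1 + t), φ i] (fun k => φ k)) := by
  have hne : ∀ k t, t < n k → (k = i → t ≠ p) → (k = i → t ≠ p + q + 1) →
      (σ * Equiv.swap (φ i (p + q + 1)) (φ i p)) (φ k t) = σ (φ k t) := by
    intro k t hk h1 h2
    rw [Equiv.Perm.mul_apply, Equiv.swap_apply_of_ne_of_ne]
    · intro heq
      obtain ⟨rfl, rfl⟩ := h.inj _ _ _ _ hk (by omega) heq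
      exact h2 rfl rfl
    · intro heq
      obtain ⟨rfl, rfl⟩ := h.inj _ _ _ _ hk (by omega) heq
      exact h1 rfl rfl
  refine ⟨?_, ?_, ?_, ?_⟩
  · rintro (a | ⟨k, hk1⟩) t hk
    · fin_cases a
      · replace hk : t + 1 < q + 1 := hk
        change (σ * _) (φ i (p + 1 + t)) = φ i (p + 1 + (t + 1))
        rw [hne i _ (by omega) (fun _ => by omega) (fun _ => by omega), h.step i _ (by omega)]
        rfl
      · replace hk : t + 1 < p + 1 := hk
        change (σ * _) (φ i t) = φ i (t + 1)
        rw [hne i _ (by omega) (fun _ => by omega) (fun _ => by omega), h.step i _ (by omega)]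
    · replace hk : t + 1 < n k := hk
      simp only [Sum.elim_inr]
      rw [hne k t (by omega) (fun h => absurd h hk1) (fun h => absurd h hk1), h.step k t hk]
  · rintro (a | ⟨k, hk1⟩) t hk
    · fin_cases a
      · replace hk : t + 1 = q + 1 := hk
        change (σ * _) (φ i (p + 1 + t)) = φ i (p + 1 + 0)
        rw [show p + 1 + t = p + q + 1 by omega, Equiv.Perm.mul_apply, Equiv.swap_apply_left,
          h.step i _ (by omega), add_zero]
      · replace hk : t + 1 = p + 1 := hk
        change (σ * _) (φ i t) = φ i 0
        rw [show t = p by omega, Equiv.Perm.mul_apply, Equiv.swap_apply_right,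
          h.wrap i _ (by omega)]
    · replace hk : t + 1 = n k := hk
      simp only [Sum.elim_inr]
      rw [hne k t (by omega) (fun h => absurd h hk1) (fun h => absurd h hk1), h.wrap k t hk]
  · have key : ∀ (a : Fin 2) (t : ℕ), t < ![q + 1, p + 1] a →
        ∃ t', t' < n i ∧ (![fun t => φ i (p + 1 + t), φ i] : Fin 2 → ℕ → U) a t = φ i t' ∧
          t' = (if a = 0 then p + 1 + t else t) := by
      intro a t ht
      fin_cases a
      · replace ht : t < q + 1 := ht
        exact ⟨p + 1 + t, by omega, rfl, rfl⟩
      · replace ht : t < p + 1 := ht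
        exact ⟨t, by omega, rfl, rfl⟩
    rintro (a | ⟨k, hk⟩) t (a' | ⟨k', hk'⟩) t' ht ht' heq
    · obtain ⟨s, hs1, hs2, hs3⟩ := key a t ht
      obtain ⟨s', hs1', hs2', hs3'⟩ := key a' t' ht'
      replace heq : (![fun t => φ i (p + 1 + t), φ i] : Fin 2 → ℕ → U) a t =
        (![fun t => φ i (p + 1 + t), φ i] : Fin 2 → ℕ → U) a' t' := heq
      rw [hs2, hs2'] at heq
      have h1 := (h.inj _ _ _ _ hs1 hs1' heq).2
      fin_cases a <;> fin_cases a'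
      · simp at hs3 hs3'
        exact ⟨rfl, by omega⟩
      · replace ht' : t' < p + 1 := ht'
        simp at hs3 hs3'
        omega
      · replace ht : t < p + 1 := ht
        simp at hs3 hs3'
        omega
      · simp at hs3 hs3'
        exact ⟨rfl, by omega⟩
    · obtain ⟨s, hs1, hs2, hs3⟩ := key a t ht
      exact absurd (h.inj _ _ _ _ hs1 ht' (hs2.symm.trans heq)).1.symm hk'
    · obtain ⟨s, hs1, hs2, hs3⟩ := key a' t' ht'
      exact absurd (h.inj _ _ _ _ ht hs1 (heq.trans hs2)).1 hk
    · obtain ⟨h1, h2⟩ := h.inj _ _ _ _ ht ht' heq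
      exact ⟨congrArg Sum.inr (Subtype.ext h1), h2⟩
  · intro u
    obtain ⟨k, t, ht, rfl⟩ := h.surj u
    by_cases hki : k = i
    · subst hki
      rcases Nat.lt_or_ge t (p + 1) with h1 | h1
      · exact ⟨Sum.inl 1, t, h1, rfl⟩
      · refine ⟨Sum.inl 0, t - (p + 1), ?_, ?_⟩
        · change t - (p + 1) < q + 1
          omega
        · change φ k (p + 1 + (t - (p + 1))) = φ k t
          congr 1
          omega
    · exact ⟨Sum.inr ⟨k, hki⟩, t, ht, rfl⟩

end CycleParam

/-! ### The recursion for labelled counts, and their vanishing for too few glued pairs. -/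

section Recursion

/-- The number of boundaries with no edges, that is, of punctures. -/
def numZeros {ι : Type} [Fintype ι] (n : ι → ℕ) : ℕ :=
  (Finset.univ.filter fun i : ι => n i = 0).card

theorem numZeros_update_of_eq {ι : Type} [Fintype ι] [DecidableEq ι] {n : ι → ℕ} {i : ι}
    (h : n i = 0) (s : ℕ) : numZeros (Function.update n i (s + 1)) + 1 = numZeros n := by
  unfold numZeros
  have : (Finset.univ.filter fun k => n k = 0) =
      insert i (Finset.univ.filter fun k => Function.update n i (s + 1) k = 0) := by
    ext k
    by_cases hk : k = i
    · subst hk; simp [h]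
    · simp [hk]
  rw [this, Finset.card_insert_of_notMem (by simp)]

theorem numZeros_update_of_ne {ι : Type} [Fintype ι] [DecidableEq ι] {n : ι → ℕ} {i : ι}
    (h : n i ≠ 0) (s : ℕ) : numZeros (Function.update n i (s + 1)) = numZeros n := by
  unfold numZeros
  congr 1
  ext k
  by_cases hk : k = i
  · subst hk; simp [h]
  · simp [hk]

theorem numZeros_mergeLengths {ι : Type} [Fintype ι] [DecidableEq ι] {n : ι → ℕ} {i j : ι}
    (hi : n i ≠ 0) (hj : n j ≠ 0) (s : ℕ) :
    numZeros (mergeLengths n i j (s + 1)) = numZeros n := by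
  have h0 : ∀ a, mergeLengths n i j (s + 1) (Sum.inl a) ≠ 0 := by
    intro a
    rw [Subsingleton.elim a 0]
    exact Nat.succ_ne_zero s
  refine Finset.card_bij (fun k _ => Sum.elim (fun _ => i) Subtype.val k) ?_ ?_ ?_
  · rintro (a | k) hk
    · exact absurd (Finset.mem_filter.1 hk).2 (h0 a)
    · exact Finset.mem_filter.2 ⟨Finset.mem_univ _, (Finset.mem_filter.1 hk).2⟩
  · rintro (a | k) hk (a' | k') hk' h
    · rw [Subsingleton.elim a a']
    · exact absurd (Finset.mem_filter.1 hk).2 (h0 a)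
    · exact absurd (Finset.mem_filter.1 hk').2 (h0 a')
    · exact congrArg Sum.inr (Subtype.ext h)
  · intro k hk
    have hk0 := (Finset.mem_filter.1 hk).2
    have hki : k ≠ i := by rintro rfl; exact hi hk0
    have hkj : k ≠ j := by rintro rfl; exact hj hk0
    exact ⟨Sum.inr ⟨k, hki, hkj⟩, Finset.mem_filter.2 ⟨Finset.mem_univ _, hk0⟩, rfl⟩

theorem numZeros_splitLengths {ι : Type} [Fintype ι] [DecidableEq ι] {n : ι → ℕ} {i : ι}
    (hi : n i ≠ 0) (s t : ℕ) :
    numZeros (splitLengths n i (s + 1) (t + 1)) = numZeros n := by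
  have h0 : ∀ a, splitLengths n i (s + 1) (t + 1) (Sum.inl a) ≠ 0 := by
    intro a
    fin_cases a
    · exact Nat.succ_ne_zero s
    · exact Nat.succ_ne_zero t
  refine Finset.card_bij (fun k _ => Sum.elim (fun _ => i) Subtype.val k) ?_ ?_ ?_
  · rintro (a | k) hk
    · exact absurd (Finset.mem_filter.1 hk).2 (h0 a)
    · exact Finset.mem_filter.2 ⟨Finset.mem_univ _, (Finset.mem_filter.1 hk).2⟩
  · rintro (a | k) hk (a' | k') hk' h
    · exact absurd (Finset.mem_filter.1 hk).2 (h0 a)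
    · exact absurd (Finset.mem_filter.1 hk).2 (h0 a)
    · exact absurd (Finset.mem_filter.1 hk').2 (h0 a')
    · exact congrArg Sum.inr (Subtype.ext h)
  · intro k hk
    have hk0 := (Finset.mem_filter.1 hk).2
    have hki : k ≠ i := by rintro rfl; exact hi hk0
    exact ⟨Sum.inr ⟨k, hki⟩, Finset.mem_filter.2 ⟨Finset.mem_univ _, hk0⟩, rfl⟩

/-- Insertion places are regrouped by boundary. The single place `none` stands for all `P`
punctures: `P! = P * (P - 1)!` turns it into one term for each `i` with `n i = 0`, which is why such
an `i` has `tilde (n i) = 1`. -/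
theorem IsCycleParam.sum_option {ι U : Type} [Fintype ι] [DecidableEq ι] [Fintype U]
    {σ : Equiv.Perm U} {n : ι → ℕ} {φ : ι → ℕ → U} (h : IsCycleParam σ n φ)
    (H : Option U → ℕ → ℚ) :
    ((numZeros n).factorial : ℚ) * ∑ b : Option U,
      (if noneCount b ≤ numZeros n then H b (numZeros n - noneCount b) else 0) =
    ∑ i, ∑ x ∈ Finset.range (tilde (n i)),
      ((numZeros (Function.update n i (n i + 1))).factorial : ℚ) *
        H (if n i = 0 then none else some (φ i x)) (numZeros (Function.update n i (n i + 1))) := by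
  have h1 : ∀ i, (∑ x ∈ Finset.range (tilde (n i)),
      ((numZeros (Function.update n i (n i + 1))).factorial : ℚ) *
        H (if n i = 0 then none else some (φ i x)) (numZeros (Function.update n i (n i + 1)))) =
      (if n i = 0 then ((numZeros n - 1).factorial : ℚ) * H none (numZeros n - 1) else 0) +
      ∑ x ∈ Finset.range (n i), ((numZeros n).factorial : ℚ) * H (some (φ i x)) (numZeros n) := by
    intro i
    by_cases hi : n i = 0
    · have h2 : numZeros (Function.update n i (n i + 1)) = numZeros n - 1 := by
        rw [← numZeros_update_of_eq hi (n i), Nat.add_sub_cancel]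
      simp only [h2, if_pos hi]
      rw [hi]
      simp [tilde]
    · simp [numZeros_update_of_ne hi, hi, tilde]
  rw [Finset.sum_congr rfl fun i _ => h1 i, Finset.sum_add_distrib, Fintype.sum_option, mul_add]
  congr 1
  · rw [← Finset.sum_filter, Finset.sum_const]
    change _ = numZeros n • _
    simp only [noneCount, nsmul_eq_mul]
    rcases hP : numZeros n with _ | P
    · simp
    · simp [Nat.factorial_succ, mul_assoc]
  · rw [← h.equiv.sum_comp, Fintype.sum_sigma, Finset.mul_sum]
    refine Finset.sum_congr rfl fun i _ => ?_
    rw [Finset.mul_sum, Finset.sum_range]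
    simp [noneCount]

/-- The number of labelled gluings of an `N`-gon with `m` glued pairs and boundary lengths `n`,
where also the punctures are labelled. -/
noncomputable def labelledCount {ι : Type} [Fintype ι] (N m : ℕ) (n : ι → ℕ) : ℚ :=
  ((numZeros n).factorial : ℚ) * Nat.card (LabelledGluing N m (nextEdge n) (numZeros n))

section
variable {ι U : Type} [DecidableEq ι] [DecidableEq U]
    {σ : Equiv.Perm U} {n : ι → ℕ} {φ : ι → ℕ → U}

theorem IsCycleParam.insertNone_at (h : IsCycleParam σ n φ) (i : ι) {x : ℕ}
    (hx : x < tilde (n i)) :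
    IsCycleParam (PolygonGluing.insertNone (if n i = 0 then none else some (φ i x)) σ)
      (Function.update n i (n i + 1))
      (fun k t => if k = i ∧ t = n i then none else
        some (if k = i then φ i ((t + x) % n i) else φ k t)) := by
  refine (h.rotate i x).insertNone i ?_
  by_cases hi : n i = 0
  · simp [hi]
  · rw [tilde, if_neg hi] at hx
    simp [hi, Nat.mod_eq_of_lt hx]

variable [Fintype ι]

/-- With the origins rotated to `x` and `y`, both new points are last on their cycles and `merge`
applies. The value depends on neither `x` nor `y`, so these later sum to factors `tilde`. -/
theorem labelledCount_of_merge (h : IsCycleParam σ n φ) {i j : ι} (hij : i ≠ j) {x y : ℕ}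
    (hx : x < tilde (n i)) (hy : y < tilde (n j)) (N m : ℕ) :
    let n' := Function.update n i (n i + 1)
    let φ' : ι → ℕ → Option U := fun k t => if k = i ∧ t = n i then none else
        some (if k = i then φ i ((t + x) % n i) else φ k t)
    let P := numZeros (Function.update n' j (n' j + 1))
    (P.factorial : ℚ) * Nat.card (LabelledGluing N m
      (insertNone (if n' j = 0 then none else some (φ' j y))
        (insertNone (if n i = 0 then none else some (φ i x)) σ) *
        Equiv.swap none (some none)) P) =
    labelledCount N m (mergeLengths n i j (n i + n j + 2)) := by
  intro n' φ' P
  have hn : ∀ k, k ≠ i → n' k = n k := fun k hk => Function.update_of_ne hk _ _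
  have hi : n' i = n i + 1 := Function.update_self _ _ _
  have hj : n' j = n j := hn j hij.symm
  have h1 : IsCycleParam _ n' φ' := h.insertNone_at i hx
  have h2 := h1.insertNone_at j (x := y) (by rwa [hj])
  have h3 := h2.merge hij (p := n i) (q := n j)
    (by rw [Function.update_of_ne hij, hi]) (by rw [Function.update_self, hj])
  simp only [hj, and_self, hij, false_and, if_true, if_false] at h3
  have h4 : φ' i (n i) = none := by simp [φ']
  rw [h4, Equiv.swap_comm] at h3
  have h5 : mergeLengths (Function.update n' j (n j + 1)) i j (n i + n j + 2) =
      mergeLengths n i j (n i + n j + 2) := by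
    unfold mergeLengths
    congr 1
    funext k
    rw [Function.update_of_ne k.2.2, hn k k.2.1]
  have h6 : P = numZeros (mergeLengths n i j (n i + n j + 2)) := by
    rw [← h5, numZeros_mergeLengths]
    · rw [← hj]
    · rw [Function.update_of_ne hij, hi]; omega
    · rw [Function.update_self]; omega
  rw [h5] at h3
  rw [labelledCount, ← h6, ← h3.natCard_labelledGluing N m P, hj]

/-- The first new point sits at `n i`; rotating by `y` for the second insertion moves it to `n i -
y`, while the second point takes the last position `n i + 1`. Here `y` determines the two lengths.
-/
theorem labelledCount_of_split (h : IsCycleParam σ n φ) {i : ι} {x y : ℕ}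
    (hx : x < tilde (n i)) (hy : y < n i + 1) (N m : ℕ) :
    let n' := Function.update n i (n i + 1)
    let φ' : ι → ℕ → Option U := fun k t => if k = i ∧ t = n i then none else
        some (if k = i then φ i ((t + x) % n i) else φ k t)
    let P := numZeros (Function.update n' i (n' i + 1))
    (P.factorial : ℚ) * Nat.card (LabelledGluing N m
      (insertNone (if n' i = 0 then none else some (φ' i y))
        (insertNone (if n i = 0 then none else some (φ i x)) σ) *
        Equiv.swap none (some none)) P) =
    labelledCount N m (splitLengths n i (y + 1) (n i - y + 1)) := by
  intro n' φ' P
  have hi : n' i = n i + 1 := Function.update_self _ _ _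
  have h1 : IsCycleParam _ n' φ' := h.insertNone_at i hx
  have h2 := h1.insertNone_at i (x := y) (by rw [hi, tilde, if_neg (by omega)]; exact hy)
  have h4 : φ' i (n i) = none := by simp [φ']
  obtain ⟨φ₂, h2, hk, hl⟩ : ∃ φ₂, IsCycleParam
      (insertNone (if n' i = 0 then none else some (φ' i y))
        (insertNone (if n i = 0 then none else some (φ i x)) σ))
      (Function.update n' i (n' i + 1)) φ₂ ∧ φ₂ i (n i + 1) = none ∧
        φ₂ i (n i - y) = some none := by
    refine ⟨_, h2, if_pos ⟨rfl, hi.symm⟩, ?_⟩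
    rw [if_neg (by omega), if_pos rfl, hi, Nat.sub_add_cancel (by omega),
      Nat.mod_eq_of_lt (by omega), h4]
  have h3 := h2.split (i := i) (p := n i - y) (q := y) (by rw [Function.update_self, hi]; omega)
  rw [show n i - y + y + 1 = n i + 1 by omega, hk, hl, hi] at h3
  have h5 : splitLengths (Function.update n' i (n i + 1 + 1)) i (y + 1) (n i - y + 1) =
      splitLengths n i (y + 1) (n i - y + 1) := by
    unfold splitLengths
    congr 1
    funext k
    rw [Function.update_of_ne k.2]
    exact Function.update_of_ne k.2 _ _
  have h6 : P = numZeros (splitLengths n i (y + 1) (n i - y + 1)) := by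
    rw [← h5, numZeros_splitLengths]
    · rw [← hi]
    · rw [Function.update_self]; omega
  rw [h5] at h3
  rw [labelledCount, ← h6, ← h3.natCard_labelledGluing N m P, hi]

end

theorem sum_range_split (f : ℕ → ℕ → ℚ) (n : ℕ) :
    ∑ y ∈ Finset.range (n + 1), f (y + 1) (n - y + 1) =
      ∑ x ∈ Finset.Icc 1 (n + 1), f (n + 2 - x) x := by
  refine Finset.sum_bij' (fun y _ => n - y + 1) (fun x _ => n + 1 - x) ?_ ?_ ?_ ?_ ?_
  · intro y hy
    simp only [Finset.mem_range, Finset.mem_Icc] at *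
    omega
  · intro y hy
    simp only [Finset.mem_range, Finset.mem_Icc] at *
    omega
  · intro y hy
    simp only [Finset.mem_range] at *
    omega
  · intro y hy
    simp only [Finset.mem_Icc] at *
    omega
  · intro y hy
    simp only [Finset.mem_range] at *
    rw [show n + 2 - (n - y + 1) = y + 1 by omega]

/-- The first freed edge goes to boundary `i`, the second to `j`. The freed edges are
distinguishable, so pairs `(i, j)` are ordered. For `j = i` the boundary already has `n i + 1`
edges, hence that many places even if it was a puncture. -/
theorem labelledCount_succ {ι : Type} [Fintype ι] [DecidableEq ι] (N m : ℕ) (n : ι → ℕ)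
    (hpos : ∃ i, 0 < n i) :
    labelledCount N (m + 1) n = ∑ i, (tilde (n i) : ℚ) *
      (∑ j ∈ Finset.univ.erase i,
          (tilde (n j) : ℚ) * labelledCount N m (mergeLengths n i j (n i + n j + 2)) +
        ∑ x ∈ Finset.Icc 1 (n i + 1), labelledCount N m (splitLengths n i (n i + 2 - x) x)) := by
  obtain ⟨i₀, hi₀⟩ := hpos
  have : Nonempty (Σ i, Fin (n i)) := ⟨⟨i₀, 0, hi₀⟩⟩
  obtain ⟨φ, hφ⟩ := exists_isCycleParam_nextEdge n
  let H : Option (Σ i, Fin (n i)) → ℕ → ℚ := fun b P => ∑ a : Option (Option (Σ i, Fin (n i))),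
    if noneCount a ≤ P then (Nat.card (LabelledGluing N m
      (insertNone a (insertNone b (nextEdge n)) * Equiv.swap none (some none))
        (P - noneCount a)) : ℚ) else 0
  have h1 : labelledCount N (m + 1) n = ((numZeros n).factorial : ℚ) *
      ∑ b : Option (Σ i, Fin (n i)),
        (if noneCount b ≤ numZeros n then H b (numZeros n - noneCount b) else 0) := by
    rw [labelledCount, natCard_labelledGluing_succ, Nat.cast_sum]
    congr 1
    refine Finset.sum_congr rfl fun b _ => ?_
    rw [Nat.cast_sum]
    split_ifs with hb
    · refine Finset.sum_congr rfl fun a _ => ?_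
      by_cases ha : noneCount a ≤ numZeros n - noneCount b
      · rw [if_pos ha, if_pos (by omega), Nat.sub_sub]
      · rw [if_neg ha, if_neg (by omega), Nat.cast_zero]
    · refine Finset.sum_eq_zero fun a _ => ?_
      rw [if_neg (by omega), Nat.cast_zero]
  rw [h1, hφ.sum_option H]
  refine Finset.sum_congr rfl fun i _ => ?_
  -- The factor `tilde (n i)` is spread over the places `x`, each of which contributes equally.
  rw [← nsmul_eq_mul, ← Finset.card_range (tilde (n i)), ← Finset.sum_const, Finset.card_range]
  refine Finset.sum_congr rfl fun x hx => ?_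
  rw [Finset.mem_range] at hx
  have h2 := hφ.insertNone_at i hx
  rw [show H _ _ = _ from rfl, h2.sum_option (fun a P => (Nat.card (LabelledGluing N m
    (insertNone a (insertNone (if n i = 0 then none else some (φ i x)) (nextEdge n)) *
      Equiv.swap none (some none)) P) : ℚ)), ← Finset.sum_erase_add _ _ (Finset.mem_univ i)]
  congr 1
  · refine Finset.sum_congr rfl fun j hj => ?_
    have hji : j ≠ i := Finset.ne_of_mem_erase hj
    have hj : Function.update n i (n i + 1) j = n j := Function.update_of_ne hji _ _
    rw [← nsmul_eq_mul, hj]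
    conv_rhs => rw [← Finset.card_range (tilde (n j)), ← Finset.sum_const]
    refine Finset.sum_congr rfl fun y hy => ?_
    rw [Finset.mem_range] at hy
    have := labelledCount_of_merge hφ hji.symm hx hy N m
    simp only [hj] at this
    exact this
  · rw [← sum_range_split (fun s t => labelledCount N m (splitLengths n i s t))]
    refine Finset.sum_congr ?_ fun y hy => ?_
    · rw [Function.update_self, tilde, if_neg (by omega)]
    · rw [Finset.mem_range] at hy
      exact labelledCount_of_split hφ hx hy N m

theorem eq_of_finRotate_invariant {N : ℕ} {β : Type} {F : Fin N → β}
    (h : ∀ k, F (finRotate N k) = F k) (k l : Fin N) : F k = F l := by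
  obtain ⟨M, rfl⟩ : ∃ M, N = M + 1 := ⟨N - 1, by have := k.2; omega⟩
  have : ∀ t (ht : t < M + 1), F ⟨t, ht⟩ = F 0 := by
    intro t
    induction t with
    | zero => intro ht; rfl
    | succ t ih =>
      intro ht
      rw [← ih (by omega), ← h ⟨t, by omega⟩, finRotate_of_lt (by omega)]
  exact (this k.1 k.2).trans (this l.1 l.2).symm

/-- With nothing glued the boundary permutation is the rotation, a single cycle through named edges
only: there is no puncture and just one boundary. -/
theorem isEmpty_labelledGluing_zero {ι : Type} [Fintype ι] (N : ℕ) (n : ι → ℕ)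
    (hι : 1 < Fintype.card ι) : IsEmpty (LabelledGluing N 0 (nextEdge n) (numZeros n)) := by
  refine ⟨?_⟩
  rintro ⟨e, he⟩
  let j : (Σ i, Fin (n i)) ≃ Fin N := (Equiv.sumEmpty _ (Fin 0 × Bool)).symm.trans e.symm
  have h1 := isTrace_of_equiv (boundaryPerm e) j
  have h2 : numZeros n = 0 := IsTrace.free_unique he h1
  have h3 := IsTrace.perm_unique he h1
  have hpos : ∀ i, 0 < n i := by
    intro i
    rw [numZeros, Finset.card_eq_zero, Finset.filter_eq_empty_iff] at h2
    exact Nat.pos_of_ne_zero (h2 (Finset.mem_univ i))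
  have hb : ∀ k, boundaryPerm e k = finRotate N k := by
    intro k
    have : flipPair (Σ i, Fin (n i)) 0 (e k) = e k := by
      rcases e k with u | ⟨a, -⟩
      · rfl
      · exact a.elim0
    simp [boundaryPerm, this]
  have hF : ∀ k, (j.symm (finRotate N k)).1 = (j.symm k).1 := by
    intro k
    have h4 := congrArg (fun μ : Equiv.Perm _ => μ (j.symm k)) h3
    simp only [Equiv.trans_apply, Equiv.apply_symm_apply, hb] at h4
    rw [← h4]
    rfl
  obtain ⟨i, i', hi⟩ := Fintype.exists_ne_of_one_lt_card hι |> fun h => (⟨_, _, (h (Classical.choice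
    (Fintype.card_pos_iff.1 (by omega)))).choose_spec⟩ : ∃ i i' : ι, i ≠ i')
  have := eq_of_finRotate_invariant (F := fun k => (j.symm k).1) hF (j ⟨i, 0, hpos i⟩) (j ⟨i', 0, hpos i'⟩)
  simp only [Equiv.symm_apply_apply] at this
  exact hi this

/-- These are the would-be surfaces of negative genus. Ungluing lowers `m` by one and the number of
boundaries by at most one, so the inequality descends to `m = 0`. This matches the convention for `g
< 0`. -/
theorem labelledCount_eq_zero {ι : Type} [Fintype ι] (N m : ℕ) (n : ι → ℕ)
    (hpos : ∃ i, 0 < n i) (hm : m + 1 < Fintype.card ι) : labelledCount N m n = 0 := by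
  classical
  induction m generalizing ι with
  | zero =>
    have := isEmpty_labelledGluing_zero N n (by omega)
    rw [labelledCount, Nat.card_of_isEmpty, Nat.cast_zero, mul_zero]
  | succ m ih =>
    rw [labelledCount_succ N m n hpos]
    refine Finset.sum_eq_zero fun i _ => ?_
    rw [Finset.sum_eq_zero, Finset.sum_eq_zero, add_zero, mul_zero]
    · intro x hx
      refine ih _ ⟨Sum.inl 1, (Finset.mem_Icc.1 hx).1⟩ ?_
      rw [Fintype.card_sum, Fintype.card_fin, Fintype.card_subtype_compl, Fintype.card_subtype_eq]
      omega
    · intro j hj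
      rw [ih _ ⟨Sum.inl 0, by change 0 < n i + n j + 2; omega⟩, mul_zero]
      have : Fintype.card {k // k ≠ i ∧ k ≠ j} = Fintype.card ι - 2 := by
        rw [Fintype.card_subtype, ← Finset.card_pair (Finset.ne_of_mem_erase hj),
          ← Finset.card_univ, ← Finset.card_sdiff_of_subset (Finset.subset_univ _)]
        congr 1
        ext k
        simp [and_comm]
      rw [Fintype.card_sum, Fintype.card_fin, this]
      omega

end Recursion

/-! ### Translation between words and labelled gluings. -/

section Words

variable {ι : Type} {n : ι → ℕ} {N m : ℕ}

/-- The word along the boundary of a polygon with labelled edges, if the `a`-th glued pair is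
given the letter `ℓ a`. -/
def wordOf (ℓ : Fin m → ℕ) (e : Fin N ≃ (Σ i, Fin (n i)) ⊕ Fin m × Bool) : Word n N :=
  fun k => Sum.map id (fun p => ℓ p.1) (e k)

theorem wordOf_eq_inl {ℓ : Fin m → ℕ} {e : Fin N ≃ (Σ i, Fin (n i)) ⊕ Fin m × Bool} {k : Fin N}
    {u : Σ i, Fin (n i)} : wordOf ℓ e k = Sum.inl u ↔ k = e.symm (Sum.inl u) := by
  rw [Equiv.eq_symm_apply, wordOf]
  rcases e k with v | p <;> simp

theorem boundaryPerm_apply_inl {U : Type} (e : Fin N ≃ U ⊕ Fin m × Bool) (u : U) :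
    boundaryPerm e (e.symm (Sum.inl u)) = finRotate N (e.symm (Sum.inl u)) := by
  simp [boundaryPerm]

theorem glued_wordOf {ℓ : Fin m → ℕ} (hℓ : Function.Injective ℓ)
    {e : Fin N ≃ (Σ i, Fin (n i)) ⊕ Fin m × Bool} {k l : Fin N} :
    (wordOf ℓ e).Glued k l ↔ k ∉ Set.range (e.symm ∘ Sum.inl) ∧
      l = e.symm (flipPair _ m (e k)) := by
  obtain ⟨x, rfl⟩ := e.symm.surjective k
  obtain ⟨y, rfl⟩ := e.symm.surjective l
  simp only [Word.Glued, wordOf, Equiv.apply_symm_apply, ne_eq, EmbeddingLike.apply_eq_iff_eq,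
    Set.mem_range, Function.comp]
  rcases x with u | ⟨a, b⟩ <;> rcases y with v | ⟨a', b'⟩
  · simp
  · simp
  · simp
  · simp only [Sum.inr.injEq, Prod.mk.injEq, Sum.map_inr, hℓ.eq_iff, flipPair_inr, reduceCtorEq,
      exists_false, not_false_eq_true, true_and, not_and]
    constructor
    · rintro ⟨h1, rfl⟩
      refine ⟨rfl, ?_⟩
      have := h1 rfl
      cases b <;> cases b' <;> simp_all
    · rintro ⟨rfl, rfl⟩
      exact ⟨fun _ => by cases b <;> simp, rfl⟩

/-- The start of a glued edge is identified with the end of its partner, which is exactly its image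
under `boundaryPerm`. Unglued edges generate nothing. -/
theorem vertexSetoid_wordOf {ℓ : Fin m → ℕ} (hℓ : Function.Injective ℓ)
    (e : Fin N ≃ (Σ i, Fin (n i)) ⊕ Fin m × Bool) :
    (wordOf ℓ e).vertexSetoid = chainSetoid (boundaryPerm e) (e.symm ∘ Sum.inl) := by
  unfold Word.vertexSetoid chainSetoid
  congr 1
  funext u v
  apply propext
  constructor
  · rintro ⟨k, l, h, rfl, rfl⟩
    obtain ⟨h1, rfl⟩ := (glued_wordOf hℓ).1 h
    exact ⟨h1, rfl⟩
  · rintro ⟨h1, rfl⟩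
    exact ⟨u, _, (glued_wordOf hℓ).2 ⟨h1, rfl⟩, rfl, rfl⟩

theorem isSemiGaussian_wordOf {ℓ : Fin m → ℕ} (hℓ : Function.Injective ℓ)
    (e : Fin N ≃ (Σ i, Fin (n i)) ⊕ Fin m × Bool) : (wordOf ℓ e).IsSemiGaussian := by
  constructor
  · intro u
    exact ⟨e.symm (Sum.inl u), wordOf_eq_inl.2 rfl, fun k hk => wordOf_eq_inl.1 hk⟩
  · intro a
    by_cases ha : ∃ i, ℓ i = a
    · obtain ⟨i, rfl⟩ := ha
      right
      rw [Set.ncard_eq_two]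
      refine ⟨e.symm (Sum.inr (i, true)), e.symm (Sum.inr (i, false)), by simp, ?_⟩
      ext k
      obtain ⟨x, rfl⟩ := e.symm.surjective k
      rcases x with u | ⟨a, b⟩
      · simp [wordOf]
      · cases b <;> simp [wordOf, hℓ.eq_iff]
    · left
      rw [Set.ncard_eq_zero, Set.eq_empty_iff_forall_notMem]
      intro k hk
      apply ha
      rw [Set.mem_ofPred_eq, wordOf] at hk
      rcases hx : e k with u | ⟨i, b⟩
      · simp [hx] at hk
      · exact ⟨i, by simpa [hx] using hk⟩

theorem ncard_range_wordOf [Fintype ι] {ℓ : Fin m → ℕ} (hℓ : Function.Injective ℓ)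
    (e : Fin N ≃ (Σ i, Fin (n i)) ⊕ Fin m × Bool) :
    (Set.range (wordOf ℓ e)).ncard = Fintype.card (Σ i, Fin (n i)) + m := by
  have h : Set.range (wordOf ℓ e) =
      Set.range (Sum.map id ℓ : (Σ i, Fin (n i)) ⊕ Fin m → Letter n) := by
    ext y
    constructor
    · rintro ⟨k, rfl⟩
      unfold wordOf
      rcases e k with u | p
      · exact ⟨Sum.inl u, rfl⟩
      · exact ⟨Sum.inr p.1, rfl⟩
    · rintro ⟨u | a, rfl⟩
      · exact ⟨e.symm (Sum.inl u), by simp [wordOf]⟩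
      · exact ⟨e.symm (Sum.inr (a, true)), by simp [wordOf]⟩
  rw [h, ← Set.image_univ, Set.ncard_image_of_injective _ (Function.Injective.sumMap
    Function.injective_id hℓ), Set.ncard_univ, Nat.card_eq_fintype_card, Fintype.card_sum,
    Fintype.card_fin]

theorem IsTrace.natCard_quotient {X U : Type} [Finite X] [Fintype U] {f : Equiv.Perm X}
    {j : U → X} {μ : Equiv.Perm U} {P : ℕ} (h : IsTrace f j μ P) :
    Nat.card (Quotient (chainSetoid f j)) = P + Fintype.card U := by
  rw [← Set.ncard_add_ncard_compl
    {v : Quotient (chainSetoid f j) | ∀ u, v ≠ Quotient.mk _ (j u)}, h.free]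
  congr 1
  have h1 : {v : Quotient (chainSetoid f j) | ∀ u, v ≠ Quotient.mk _ (j u)}ᶜ =
      (fun u => Quotient.mk (chainSetoid f j) (j u)) '' Set.univ := by
    ext v
    simp [eq_comm]
  rw [h1, Set.ncard_image_of_injective, Set.ncard_univ, Nat.card_eq_fintype_card]
  exact fun u v huv => h.inj u v (Quotient.exact huv)

theorem hasPolygonalBoundaries_wordOf {ℓ : Fin m → ℕ} (hℓ : Function.Injective ℓ)
    (e : Fin N ≃ (Σ i, Fin (n i)) ⊕ Fin m × Bool) :
    (wordOf ℓ e).HasPolygonalBoundaries ↔ ∀ u, (chainSetoid (boundaryPerm e)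
      (e.symm ∘ Sum.inl)).r (boundaryPerm e (e.symm (Sum.inl u)))
        (e.symm (Sum.inl (nextEdge n u))) := by
  rw [← vertexSetoid_wordOf hℓ]
  constructor
  · rintro h ⟨i, j⟩
    rw [boundaryPerm_apply_inl]
    exact Quotient.exact (h i j _ _ (wordOf_eq_inl.2 rfl) (wordOf_eq_inl.2 rfl))
  · intro h i j k l hk hl
    rw [wordOf_eq_inl] at hk hl
    have := h ⟨i, j⟩
    rw [boundaryPerm_apply_inl] at this
    subst hk hl
    exact Quotient.sound this

/-- Since the boundaries close up, every end vertex of an unglued edge is also a start vertex of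
one, so only start vertices need excluding. -/
theorem ncard_punctures_wordOf {ℓ : Fin m → ℕ} (hℓ : Function.Injective ℓ)
    (e : Fin N ≃ (Σ i, Fin (n i)) ⊕ Fin m × Bool) (h : (wordOf ℓ e).HasPolygonalBoundaries) :
    (wordOf ℓ e).punctures.ncard =
      {v : Quotient (chainSetoid (boundaryPerm e) (e.symm ∘ Sum.inl)) |
        ∀ u, v ≠ Quotient.mk _ ((e.symm ∘ Sum.inl) u)}.ncard := by
  have h1 : (wordOf ℓ e).punctures = {v : Quotient (wordOf ℓ e).vertexSetoid |
      ∀ u, v ≠ Quotient.mk _ (e.symm (Sum.inl u))} := by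
    ext v
    constructor
    · intro hv u
      exact (hv _ u (wordOf_eq_inl.2 rfl)).1
    · rintro hv k ⟨i, j⟩ hk
      refine ⟨?_, ?_⟩
      · rw [wordOf_eq_inl.1 hk]
        exact hv _
      · rw [h i j k _ hk (wordOf_eq_inl.2 rfl)]
        exact hv _
  -- The two sets live in quotients by propositionally equal setoids; a variable setoid allows
  -- substitution.
  have h2 : ∀ s : Setoid (Fin N), s = (wordOf ℓ e).vertexSetoid →
      {v : Quotient (wordOf ℓ e).vertexSetoid |
        ∀ u, v ≠ Quotient.mk _ (e.symm (Sum.inl u))}.ncard =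
      {v : Quotient s | ∀ u, v ≠ Quotient.mk _ (e.symm (Sum.inl u))}.ncard := by
    rintro s rfl
    rfl
  exact (congrArg Set.ncard h1).trans (h2 _ (vertexSetoid_wordOf hℓ e).symm)

/-- There are `P + |U|` vertices and `|U| + m` edges, where `U` is the set of unglued edges, so the
Euler characteristic is `P - m + 1` and the genus condition becomes linear in `m`. That distinct
unglued edges start at distinct vertices is automatic, by `exists_isTrace`. -/
theorem produces_wordOf [Fintype ι] {ℓ : Fin m → ℕ} (hℓ : Function.Injective ℓ)
    (e : Fin N ≃ (Σ i, Fin (n i)) ⊕ Fin m × Bool) (g : ℤ) :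
    (wordOf ℓ e).Produces g ↔
      IsTrace (boundaryPerm e) (e.symm ∘ Sum.inl) (nextEdge n) (numZeros n) ∧
        (m : ℤ) + 1 = Fintype.card ι + 2 * g := by
  obtain ⟨μ, P, hT⟩ := exists_isTrace (boundaryPerm e) (e.symm ∘ Sum.inl)
    (e.symm.injective.comp Sum.inl_injective)
  have hcard : numZeros n + (Finset.univ.filter fun i : ι => 0 < n i).card = Fintype.card ι := by
    rw [numZeros, ← Finset.card_univ, ← Finset.card_filter_add_card_filter_not (s := Finset.univ) (fun i => n i = 0)]
    simp only [Nat.pos_iff_ne_zero, ne_eq]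
  have hV : Nat.card (wordOf ℓ e).Vertex = P + Fintype.card (Σ i, Fin (n i)) := by
    rw [← hT.natCard_quotient, Word.Vertex, vertexSetoid_wordOf hℓ e]
  have hE : P = numZeros n → ((wordOf ℓ e).eulerChar +
      ((Finset.univ.filter fun i : ι => 0 < n i).card : ℤ) = 2 - 2 * g ↔
      (m : ℤ) + 1 = Fintype.card ι + 2 * g) := by
    intro hP
    rw [Word.eulerChar, hV, ncard_range_wordOf hℓ e, hP, ← hcard]
    push_cast
    constructor <;> intro h <;> linarith
  constructor
  · rintro ⟨-, h2, h3, h4⟩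
    have h5 := (hasPolygonalBoundaries_wordOf hℓ e).1 h2
    rw [ncard_punctures_wordOf hℓ e h2] at h3
    exact ⟨⟨hT.inj, h5, h3⟩, (hE (hT.free.symm.trans h3)).1 h4⟩
  · rintro ⟨h1, h2⟩
    have h5 := (hasPolygonalBoundaries_wordOf hℓ e).2 h1.ret
    refine ⟨isSemiGaussian_wordOf hℓ e, h5, ?_, (hE (hT.free_unique h1)).2 h2⟩
    rw [ncard_punctures_wordOf hℓ e h5]
    exact h1.free

theorem exists_eq_wordOf (w : Word n N) (hw : w.IsSemiGaussian) :
    ∃ (m : ℕ) (ℓ : Fin m → ℕ) (_ : Function.Injective ℓ)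
      (e : Fin N ≃ (Σ i, Fin (n i)) ⊕ Fin m × Bool), w = wordOf ℓ e := by
  classical
  let A : Set ℕ := {a | ∃ k, w k = Sum.inr a}
  have hA : A.Finite := by
    refine ((Set.finite_range w).preimage Sum.inr_injective.injOn).subset ?_
    rintro a ⟨k, hk⟩
    exact ⟨k, hk⟩
  have : Finite A := hA
  let ε : A ≃ Fin (Nat.card A) := Finite.equivFin A
  let ℓ : Fin (Nat.card A) → ℕ := fun i => (ε.symm i).1
  have hℓ : Function.Injective ℓ := Subtype.val_injective.comp ε.symm.injective
  have h2 : ∀ i, ∃ x y, x ≠ y ∧ {k | w k = Sum.inr (ℓ i)} = {x, y} := by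
    intro i
    rcases hw.2 (ℓ i) with h | h
    · obtain ⟨k, hk⟩ := (ε.symm i).2
      rw [Set.ncard_eq_zero] at h
      exact absurd (show k ∈ {k | w k = Sum.inr (ℓ i)} from hk) (h ▸ Set.notMem_empty k)
    · exact Set.ncard_eq_two.1 h
  choose x y hxy hset using h2
  choose z hz hzu using hw.1
  have hx : ∀ i, w (x i) = Sum.inr (ℓ i) := fun i => by
    have : x i ∈ {k | w k = Sum.inr (ℓ i)} := by rw [hset]; simp
    exact this
  have hy : ∀ i, w (y i) = Sum.inr (ℓ i) := fun i => by
    have : y i ∈ {k | w k = Sum.inr (ℓ i)} := by rw [hset]; simp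
    exact this
  let E : (Σ i, Fin (n i)) ⊕ Fin (Nat.card A) × Bool → Fin N :=
    Sum.elim z fun p => if p.2 then x p.1 else y p.1
  have hE : ∀ d, w (E d) = Sum.map id (fun p => ℓ p.1) d := by
    rintro (u | ⟨i, b⟩)
    · exact hz u
    · cases b
      · exact hy i
      · exact hx i
  have hbij : Function.Bijective E := by
    constructor
    · intro d d' hdd
      have h := hE d
      rw [hdd, hE d'] at h
      rcases d with u | ⟨i, b⟩ <;> rcases d' with u' | ⟨i', b'⟩
      · exact congrArg Sum.inl (Sum.inl_injective h.symm)
      · simp at h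
      · simp at h
      · obtain rfl : i' = i := hℓ (Sum.inr_injective h)
        cases b <;> cases b'
        · rfl
        · exact absurd hdd.symm (hxy i')
        · exact absurd hdd (hxy i')
        · rfl
    · intro k
      obtain ⟨c, hk⟩ : ∃ c, w k = c := ⟨_, rfl⟩
      rcases c with u | a
      · exact ⟨Sum.inl u, (hzu u k hk).symm⟩
      · have hi : ℓ (ε ⟨a, k, hk⟩) = a := congrArg Subtype.val (ε.symm_apply_apply ⟨a, k, hk⟩)
        have hk' : k ∈ {l | w l = Sum.inr (ℓ (ε ⟨a, k, hk⟩))} := by rw [hi]; exact hk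
        rw [hset] at hk'
        rcases hk' with h | h
        · exact ⟨Sum.inr (ε ⟨a, k, hk⟩, true), h.symm⟩
        · exact ⟨Sum.inr (ε ⟨a, k, hk⟩, false), h.symm⟩
  refine ⟨Nat.card A, ℓ, hℓ, (Equiv.ofBijective E hbij).symm, ?_⟩
  funext k
  rw [wordOf, ← hE]
  exact congrArg w ((Equiv.ofBijective E hbij).apply_symm_apply k).symm

theorem exists_perm_extending {x y : Fin m → ℕ} (hx : Function.Injective x)
    (hy : Function.Injective y) : ∃ ρ : Equiv.Perm ℕ, ∀ a, ρ (x a) = y a := by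
  have := Equiv.Perm.isMultiplyPretransitive ℕ m
  obtain ⟨ρ, hρ⟩ := MulAction.exists_smul_eq (Equiv.Perm ℕ) (⟨x, hx⟩ : Fin m ↪ ℕ) ⟨y, hy⟩
  exact ⟨ρ, fun a => congrArg (fun z : Fin m ↪ ℕ => z a) hρ⟩

end Words

/-! ### The free action of relabellings, and the passage to equivalence classes. -/

section Relabelling

/-- Relabelling the glued edges by `h` and rotating the polygon by `r`. -/
def relabel {U : Type} {N m : ℕ} (r : Equiv.Perm (Fin N)) (h : Equiv.Perm (Fin m × Bool))
    (e : Fin N ≃ U ⊕ Fin m × Bool) : Fin N ≃ U ⊕ Fin m × Bool :=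
  (r.symm.trans e).trans (Equiv.sumCongr (Equiv.refl U) h)

theorem relabel_apply {U : Type} {N m : ℕ} (r : Equiv.Perm (Fin N))
    (h : Equiv.Perm (Fin m × Bool)) (e : Fin N ≃ U ⊕ Fin m × Bool) (k : Fin N) :
    relabel r h e (r k) = Sum.map id h (e k) := by
  simp [relabel]

theorem relabel_symm_inl {U : Type} {N m : ℕ} (r : Equiv.Perm (Fin N))
    (h : Equiv.Perm (Fin m × Bool)) (e : Fin N ≃ U ⊕ Fin m × Bool) (u : U) :
    (relabel r h e).symm (Sum.inl u) = r (e.symm (Sum.inl u)) := by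
  rw [Equiv.symm_apply_eq, relabel_apply, Equiv.apply_symm_apply]
  rfl

/-- The involution on the labels of glued edges. -/
def flipBool (m : ℕ) : Equiv.Perm (Fin m × Bool) :=
  Equiv.prodCongr (Equiv.refl (Fin m)) Equiv.boolNot

@[simp] theorem flipBool_apply {m : ℕ} (p : Fin m × Bool) : flipBool m p = (p.1, !p.2) := rfl

theorem IsTrace.conj {X Y U : Type} {f : Equiv.Perm X} {j : U → X} {μ : Equiv.Perm U} {P : ℕ}
    (h : IsTrace f j μ P) (ψ : X ≃ Y) {f' : Equiv.Perm Y} {j' : U → Y}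
    (hf : ∀ x, f' (ψ x) = ψ (f x)) (hj : ∀ u, j' u = ψ (j u)) : IsTrace f' j' μ P := by
  have hr : ∀ x, ψ x ∈ Set.range j' ↔ x ∈ Set.range j := by
    intro x
    simp [hj]
  have h1 : ∀ x y, (chainSetoid f j).r x y ↔ (chainSetoid f' j').r (ψ x) (ψ y) := by
    intro x y
    constructor
    · intro hxy
      refine Quotient.exact (s := chainSetoid f' j')
        (chainSetoid_lift (fun x => Quotient.mk (chainSetoid f' j') (ψ x)) (fun x hx => ?_) hxy)
      refine Quotient.sound ?_
      rw [← hf]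
      exact chainSetoid_step (by rwa [hr])
    · intro hxy
      have := chainSetoid_lift (fun y => Quotient.mk (chainSetoid f j) (ψ.symm y))
        (fun y hy => ?_) hxy
      · simp only [Equiv.symm_apply_apply] at this
        exact Quotient.exact this
      · obtain ⟨x, rfl⟩ := ψ.surjective y
        simp only [hf, Equiv.symm_apply_apply]
        exact Quotient.sound (chainSetoid_step (by rwa [hr] at hy))
  refine ⟨?_, ?_, ?_⟩
  · intro u v huv
    rw [hj, hj, ← h1] at huv
    exact h.inj u v huv
  · intro u
    rw [hj, hj, hf, ← h1]
    exact h.ret u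
  · rw [← h.free]
    symm
    refine Set.ncard_congr (fun v _ => Quotient.congr ψ h1 v) ?_ ?_ ?_
    · rintro ⟨x⟩ hx u hu
      refine hx u (Quotient.sound ((h1 _ _).2 ?_))
      rw [← hj]
      exact Quotient.exact hu
    · intro v w _ _ hvw
      exact (Quotient.congr ψ h1).injective hvw
    · rintro ⟨y⟩ hy
      obtain ⟨x, rfl⟩ := ψ.surjective y
      refine ⟨Quotient.mk _ x, fun u hu => hy u ?_, rfl⟩
      refine Quotient.sound ?_
      rw [hj]
      exact (h1 _ _).1 (Quotient.exact hu)

theorem boundaryPerm_relabel {U : Type} {N m : ℕ} {r : Equiv.Perm (Fin N)}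
    {h : Equiv.Perm (Fin m × Bool)} (hr : Commute r (finRotate N)) (hh : Commute h (flipBool m))
    (e : Fin N ≃ U ⊕ Fin m × Bool) (k : Fin N) :
    boundaryPerm (relabel r h e) (r k) = r (boundaryPerm e k) := by
  have h1 : flipPair U m (Sum.map id h (e k)) = Sum.map id h (flipPair U m (e k)) := by
    rcases e k with u | p
    · rfl
    · exact congrArg Sum.inr (congrArg (fun z : Equiv.Perm _ => z p) hh.eq).symm
  have h2 : (relabel r h e).symm (Sum.map id h (flipPair U m (e k))) =
      r (e.symm (flipPair U m (e k))) := by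
    rw [Equiv.symm_apply_eq, relabel_apply, Equiv.apply_symm_apply]
  simp only [boundaryPerm, Equiv.Perm.mul_apply, Equiv.trans_apply]
  rw [relabel_apply, h1, h2]
  exact (congrArg (fun z : Equiv.Perm _ => z (e.symm (flipPair U m (e k)))) hr.eq).symm

theorem IsTrace.relabel {U : Type} {N m : ℕ} {r : Equiv.Perm (Fin N)}
    {h : Equiv.Perm (Fin m × Bool)} (hr : Commute r (finRotate N)) (hh : Commute h (flipBool m))
    {e : Fin N ≃ U ⊕ Fin m × Bool} {ν : Equiv.Perm U} {P : ℕ}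
    (he : IsTrace (boundaryPerm e) (e.symm ∘ Sum.inl) ν P) :
    IsTrace (boundaryPerm (relabel r h e)) ((relabel r h e).symm ∘ Sum.inl) ν P :=
  he.conj r (boundaryPerm_relabel hr hh e) (relabel_symm_inl r h e)

theorem eq_one_of_commute_finRotate {N : ℕ} {s : Equiv.Perm (Fin N)}
    (hs : Commute s (finRotate N)) {k : Fin N} (hk : s k = k) : s = 1 := by
  ext l : 1
  have h1 : ∀ l, (s (finRotate N l) = finRotate N l) = (s l = l) := by
    intro l
    have := congrArg (fun z : Equiv.Perm _ => z l) hs.eq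
    simp only [Equiv.Perm.mul_apply] at this
    rw [this]
    exact propext (finRotate N).apply_eq_iff_eq
  exact (eq_of_finRotate_invariant (F := fun l => s l = l) h1 k l).mp hk

theorem fst_apply_of_commute_flipBool {m : ℕ} {h : Equiv.Perm (Fin m × Bool)}
    (hh : Commute h (flipBool m)) (a : Fin m) (b : Bool) : (h (a, b)).1 = (h (a, true)).1 := by
  cases b
  · have := congrArg (fun z : Equiv.Perm _ => (z (a, true)).1) hh.eq
    simpa using this
  · rfl

/-- A permutation commuting with the flip carries pairs to pairs, hence permutes the `m` letters. -/
theorem injective_fst_apply {m : ℕ} {h : Equiv.Perm (Fin m × Bool)}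
    (hh : Commute h (flipBool m)) : Function.Injective fun a => (h (a, true)).1 := by
  intro a a' haa
  replace haa : (h (a, true)).1 = (h (a', true)).1 := haa
  have h1 : h (a', true) = h (a, true) ∨ h (a', true) = h (a, false) := by
    have h2 := congrArg (fun z : Equiv.Perm _ => z (a, true)) hh.eq
    simp only [Equiv.Perm.mul_apply, flipBool_apply, Bool.not_true] at h2
    rw [h2]
    generalize h (a, true) = x at haa
    generalize h (a', true) = y at haa
    obtain ⟨c, d⟩ := x
    obtain ⟨c', d'⟩ := y
    obtain rfl : c = c' := haa
    cases d <;> cases d' <;> simp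
  rcases h1 with h1 | h1
  · exact (congrArg Prod.fst (h.injective h1)).symm
  · exact (congrArg Prod.fst (h.injective h1)).symm

variable {ι : Type} {n : ι → ℕ} {N m : ℕ}

theorem equivalent_wordOf_relabel {r : Equiv.Perm (Fin N)}
    {h : Equiv.Perm (Fin m × Bool)} (hr : r ∈ Subgroup.zpowers (finRotate N))
    (hh : Commute h (flipBool m)) (e : Fin N ≃ (Σ i, Fin (n i)) ⊕ Fin m × Bool) :
    (wordOf Fin.val e).Equivalent (wordOf Fin.val (relabel r h e)) := by
  obtain ⟨s, rfl⟩ := hr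
  obtain ⟨ρ, hρ⟩ := exists_perm_extending Fin.val_injective
    (Fin.val_injective.comp (injective_fst_apply hh))
  refine ⟨s, ρ, fun k => ?_⟩
  simp only [wordOf]
  rw [relabel_apply]
  rcases e k with u | ⟨a, b⟩
  · rfl
  · refine congrArg Sum.inr ?_
    change ((h (a, b)).1 : ℕ) = ρ a
    rw [hρ, fst_apply_of_commute_flipBool hh]
    rfl

/-- After the rotation, `e` and `e'` agree on boundary names, and their discrepancy on glued edges
respects the pairs, since each letter occurs on just two edges. -/
theorem exists_relabel_of_equivalent {e e' : Fin N ≃ (Σ i, Fin (n i)) ⊕ Fin m × Bool}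
    (hw : (wordOf Fin.val e).Equivalent (wordOf Fin.val e')) :
    ∃ r ∈ Subgroup.zpowers (finRotate N), ∃ h : Equiv.Perm (Fin m × Bool),
      Commute h (flipBool m) ∧ e' = relabel r h e := by
  obtain ⟨s, ρ, hρ⟩ := hw
  have h0 : ∀ d, Sum.map id (fun p : Fin m × Bool => (p.1 : ℕ))
      (e' ((finRotate N ^ s) (e.symm d))) = Sum.map id (fun p : Fin m × Bool => ρ p.1) d := by
    intro d
    have := hρ (e.symm d)
    simp only [wordOf, Equiv.apply_symm_apply] at this
    rw [this]
    rcases d with u | p <;> rfl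
  have h1 : ∀ u, e' ((finRotate N ^ s) (e.symm (Sum.inl u))) = Sum.inl u := by
    intro u
    have := h0 (Sum.inl u)
    generalize e' ((finRotate N ^ s) (e.symm (Sum.inl u))) = x at *
    rcases x with v | q
    · exact congrArg Sum.inl (Sum.inl_injective this)
    · simp at this
  have h2 : ∀ p, ∃ q, e' ((finRotate N ^ s) (e.symm (Sum.inr p))) = Sum.inr q ∧
      (q.1 : ℕ) = ρ p.1 := by
    intro p
    have := h0 (Sum.inr p)
    generalize e' ((finRotate N ^ s) (e.symm (Sum.inr p))) = x at *
    rcases x with v | q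
    · simp at this
    · exact ⟨q, rfl, Sum.inr_injective this⟩
  choose q hq hq' using h2
  have hinj : Function.Injective q := by
    intro p p' hpp
    have h3 := hq p
    rw [hpp, ← hq p'] at h3
    exact Sum.inr_injective (e.symm.injective ((finRotate N ^ s).injective (e'.injective h3)))
  let h : Equiv.Perm (Fin m × Bool) :=
    Equiv.ofBijective q (Finite.injective_iff_bijective.1 hinj)
  refine ⟨finRotate N ^ s, ⟨s, rfl⟩, h, ?_, ?_⟩
  · ext p : 1
    change q (flipBool m p) = flipBool m (q p)
    have h3 : (q (flipBool m p)).1 = (q p).1 := by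
      apply Fin.val_injective
      rw [hq', hq']
      rfl
    have h4 : q (flipBool m p) ≠ q p := fun h5 => by
      have := congrArg Prod.snd (hinj h5)
      simp at this
    rw [flipBool_apply (q p)]
    generalize q (flipBool m p) = x at *
    generalize q p = y at *
    obtain ⟨a, b⟩ := x
    obtain ⟨a', b'⟩ := y
    simp only at h3
    subst h3
    cases b <;> cases b' <;> simp_all
  · ext k : 1
    obtain ⟨l, rfl⟩ := (finRotate N ^ s).surjective k
    obtain ⟨d, rfl⟩ := e.symm.surjective l
    rw [relabel_apply, Equiv.apply_symm_apply]
    rcases d with u | p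
    · exact h1 u
    · exact hq p

/-- Freeness of the action. A named unglued edge pins down the rotation, and then the images of the
glued edges pin down `h`. -/
theorem relabel_injective [Nonempty (Σ i, Fin (n i))] {r r' : Equiv.Perm (Fin N)}
    {h h' : Equiv.Perm (Fin m × Bool)} {e : Fin N ≃ (Σ i, Fin (n i)) ⊕ Fin m × Bool}
    (hr : r ∈ Subgroup.zpowers (finRotate N)) (hr' : r' ∈ Subgroup.zpowers (finRotate N))
    (heq : relabel r h e = relabel r' h' e) : r = r' ∧ h = h' := by
  have u : Σ i, Fin (n i) := Classical.arbitrary _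
  have h1 := relabel_symm_inl r h e u
  rw [heq, relabel_symm_inl] at h1
  have h2 : Commute (r⁻¹ * r') (finRotate N) := by
    obtain ⟨s, hs⟩ := Subgroup.mul_mem _ (Subgroup.inv_mem _ hr) hr'
    rw [← hs]
    exact (Commute.refl _).zpow_left s
  have h3 : r = r' := by
    have := eq_one_of_commute_finRotate h2 (k := e.symm (Sum.inl u)) (by
      rw [Equiv.Perm.mul_apply, h1]
      simp)
    exact (inv_mul_eq_one.1 this)
  refine ⟨h3, ?_⟩
  subst h3
  ext p : 1
  have h4 := relabel_apply r h e (e.symm (Sum.inr p))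
  rw [heq, relabel_apply, Equiv.apply_symm_apply] at h4
  exact (Sum.inr_injective h4).symm

/-- The number of relabellings of an `N`-gon with `m` glued pairs: rotations of the polygon, and
permutations of the labels that respect the pairs. -/
noncomputable def numRelabellings (N m : ℕ) : ℕ :=
  Nat.card (Subgroup.zpowers (finRotate N)) * Nat.card (Subgroup.centralizer {flipBool m})

theorem natCard_eq_mul_of_fibers {α β : Type} [Finite α] (f : α → β) (hf : Function.Surjective f)
    (K : ℕ) (hK : ∀ a, Nat.card {x // f x = f a} = K) : Nat.card α = Nat.card β * K := by
  have : Finite β := Finite.of_surjective f hf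
  have := Fintype.ofFinite β
  rw [← Nat.card_congr (Equiv.sigmaFiberEquiv f), Nat.card_sigma, Finset.sum_congr rfl
    (fun b _ => ?_), Finset.sum_const, Finset.card_univ, Nat.card_eq_fintype_card, smul_eq_mul]
  obtain ⟨a, rfl⟩ := hf b
  exact hK a

/-- Each fiber of the map from labelled gluings to classes is one free orbit of the relabelling
group. -/
theorem natCard_labelledGluing_eq [Fintype ι] (g : ℤ) (hm : (m : ℤ) + 1 = Fintype.card ι + 2 * g)
    [Nonempty (Σ i, Fin (n i))] :
    Nat.card (LabelledGluing N m (nextEdge n) (numZeros n)) =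
      Nat.card (Quotient (gluingSetoid g n N)) * numRelabellings N m := by
  let Φ : LabelledGluing N m (nextEdge n) (numZeros n) → Quotient (gluingSetoid g n N) := fun e =>
    Quotient.mk _ ⟨wordOf Fin.val e.1, (produces_wordOf Fin.val_injective e.1 g).2 ⟨e.2, hm⟩⟩
  refine natCard_eq_mul_of_fibers Φ ?_ _ ?_
  · rintro ⟨w, hw⟩
    obtain ⟨m', ℓ, hℓ, e, rfl⟩ := exists_eq_wordOf w hw.1
    obtain ⟨h1, h2⟩ := (produces_wordOf hℓ e g).1 hw
    obtain rfl : m' = m := by omega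
    refine ⟨⟨e, h1⟩, Quotient.sound ?_⟩
    obtain ⟨ρ, hρ⟩ := exists_perm_extending Fin.val_injective hℓ
    refine ⟨0, ρ, fun k => ?_⟩
    simp only [wordOf, zpow_zero, Equiv.Perm.one_apply]
    rcases e k with u | p
    · rfl
    · exact congrArg Sum.inr (hρ p.1).symm
  · rintro ⟨e, he⟩
    rw [numRelabellings, ← Nat.card_prod]
    symm
    have hc : ∀ h : Subgroup.centralizer {flipBool m}, Commute h.1 (flipBool m) := fun h =>
      (Subgroup.mem_centralizer_singleton_iff.1 h.2)
    have hz : ∀ r : Subgroup.zpowers (finRotate N), Commute r.1 (finRotate N) := by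
      rintro ⟨_, s, rfl⟩
      exact (Commute.refl _).zpow_left s
    refine Nat.card_congr (Equiv.ofBijective (fun p => (⟨⟨relabel p.1.1 p.2.1 e,
      he.relabel (hz p.1) (hc p.2)⟩, ?_⟩ : {x // Φ x = Φ ⟨e, he⟩})) ⟨?_, ?_⟩)
    · exact Quotient.sound (Word.equivalent_equivalence.symm
        (equivalent_wordOf_relabel p.1.2 (hc p.2) e))
    · rintro ⟨r, h⟩ ⟨r', h'⟩ heq
      have h1 := congrArg (fun z => z.1.1) heq
      obtain ⟨h2, h3⟩ := relabel_injective r.2 r'.2 h1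
      exact Prod.ext (Subtype.ext h2) (Subtype.ext h3)
    · rintro ⟨⟨e', he'⟩, heq⟩
      obtain ⟨r, hr, h, hh, rfl⟩ := exists_relabel_of_equivalent
        (Word.equivalent_equivalence.symm (Quotient.exact heq))
      exact ⟨⟨⟨r, hr⟩, ⟨h, Subgroup.mem_centralizer_singleton_iff.2 hh⟩⟩, rfl⟩

theorem numRelabellings_pos (N m : ℕ) : 0 < numRelabellings N m :=
  Nat.mul_pos Nat.card_pos Nat.card_pos

/-- The flip is a product of `m` disjoint transpositions, so its centralizer has the order of the
hyperoctahedral group. -/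
theorem natCard_centralizer_flipBool (m : ℕ) :
    Nat.card (Subgroup.centralizer {flipBool m}) = 2 ^ m * m.factorial := by
  have h1 : flipBool m ^ 2 = 1 := by
    ext p : 1
    simp [pow_two]
  have h2 : (flipBool m).support = Finset.univ := by
    ext p
    simp [Prod.ext_iff]
  have h3 := Equiv.Perm.cycleType_of_pow_prime_eq_one h1
  have h4 : (flipBool m).cycleType.card = m := by
    have := Equiv.Perm.sum_cycleType (flipBool m)
    rw [h3, h2, Finset.card_univ, Fintype.card_prod, Fintype.card_fin, Fintype.card_bool,
      Multiset.sum_replicate, smul_eq_mul] at this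
    omega
  rw [h4] at h3
  rw [Equiv.Perm.nat_card_centralizer, h3]
  rcases m with _ | m
  · simp
  · rw [Multiset.toFinset_replicate, if_neg (by omega), Multiset.sum_replicate, smul_eq_mul, Fintype.card_prod,
      Fintype.card_fin, Fintype.card_bool, Nat.sub_self]
    simp [pow_succ']

theorem numRelabellings_succ (N m : ℕ) :
    numRelabellings N (m + 1) = 2 * (m + 1) * numRelabellings N m := by
  rw [numRelabellings, numRelabellings, natCard_centralizer_flipBool, natCard_centralizer_flipBool,
    Nat.factorial_succ]
  ring

/-- The genus fixes `m`, and `m` fixes `N`, so only one polygon size contributes to `numGluings`.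
For negative `g` both sides vanish, by `labelledCount_eq_zero`. -/
theorem rescaledNumGluings_mul [Fintype ι] (g : ℤ)
    (hm : (m : ℤ) + 1 = Fintype.card ι + 2 * g) (hN : N = ∑ i, n i + 2 * m)
    (hpos : ∃ i, 0 < n i) :
    rescaledNumGluings g n * numRelabellings N m = labelledCount N m n := by
  obtain ⟨i₀, hi₀⟩ := hpos
  have : Nonempty (Σ i, Fin (n i)) := ⟨⟨i₀, 0, hi₀⟩⟩
  by_cases hg : g < 0
  · rw [labelledCount_eq_zero N m n ⟨i₀, hi₀⟩ (by omega), rescaledNumGluings, numGluings, if_pos hg]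
    simp
  · have h1 : Nat.card (Σ N, Quotient (gluingSetoid g n N)) =
        Nat.card (Quotient (gluingSetoid g n N)) := by
      symm
      refine Nat.card_congr (Equiv.ofBijective (fun q => ⟨N, q⟩) ⟨fun q q' h => ?_, ?_⟩)
      · exact eq_of_heq (Sigma.mk.inj h).2
      rintro ⟨N', ⟨w, hw⟩⟩
      obtain ⟨m', ℓ, hℓ, e, rfl⟩ := exists_eq_wordOf w hw.1
      obtain ⟨-, h2⟩ := (produces_wordOf hℓ e g).1 hw
      obtain rfl : m' = m := by omega
      have h3 := Fintype.card_congr e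
      simp only [Fintype.card_fin, Fintype.card_sum, Fintype.card_sigma, Fintype.card_prod,
        Fintype.card_bool] at h3
      obtain rfl : N' = N := by omega
      exact ⟨_, rfl⟩
    rw [rescaledNumGluings, numGluings, if_neg hg, h1, labelledCount,
      natCard_labelledGluing_eq g hm, numZeros]
    push_cast
    ring

end Relabelling

/-! ### Assembly of the recursion for equivalence classes. -/

section BoundaryRecursion

theorem labelledCount_congr {ι κ : Type} [Fintype ι] [Fintype κ] (N m : ℕ) {n : ι → ℕ}
    {n' : κ → ℕ} (ψ : ι ≃ κ) (hψ : ∀ i, n' (ψ i) = n i) (hpos : ∃ i, 0 < n i) :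
    labelledCount N m n = labelledCount N m n' := by
  obtain ⟨i₀, hi₀⟩ := hpos
  have : Nonempty (Σ i, Fin (n i)) := ⟨⟨i₀, 0, hi₀⟩⟩
  obtain ⟨φ, hφ⟩ := exists_isCycleParam_nextEdge n
  have hψ' : ∀ k, n' k = n (ψ.symm k) := fun k => by rw [← hψ, Equiv.apply_symm_apply]
  have h : IsCycleParam (nextEdge n) n' (fun k => φ (ψ.symm k)) := by
    refine ⟨?_, ?_, ?_, ?_⟩
    · intro k t hk
      exact hφ.step _ t (by rwa [← hψ'])
    · intro k t hk
      exact hφ.wrap _ t (by rwa [← hψ'])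
    · intro k t k' t' hk hk' heq
      rw [hψ'] at hk hk'
      obtain ⟨h1, h2⟩ := hφ.inj _ _ _ _ hk hk' heq
      exact ⟨ψ.symm.injective h1, h2⟩
    · intro u
      obtain ⟨i, t, ht, rfl⟩ := hφ.surj u
      exact ⟨ψ i, t, by rwa [hψ], by simp⟩
  have h1 : numZeros n = numZeros n' := by
    refine Finset.card_equiv ψ fun i => ?_
    simp [hψ]
  rw [labelledCount, labelledCount, ← h1, h.natCard_labelledGluing]

variable {ι : Type} [Fintype ι] [DecidableEq ι]

theorem labelledCount_mergeLengths_comm (N m : ℕ) (n : ι → ℕ) (i j : ι) (s : ℕ) :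
    labelledCount N m (mergeLengths n i j (s + 1)) =
      labelledCount N m (mergeLengths n j i (s + 1)) := by
  refine labelledCount_congr N m (Equiv.sumCongr (Equiv.refl _)
    (Equiv.subtypeEquivRight fun k => and_comm)) ?_ ⟨Sum.inl 0, Nat.succ_pos s⟩
  rintro (a | k) <;> rfl

theorem card_mergeLengths_index {i j : ι} (hij : i ≠ j) :
    Fintype.card (Fin 1 ⊕ {k : ι // k ≠ i ∧ k ≠ j}) + 1 = Fintype.card ι := by
  have h1 : Fintype.card {k // k ≠ i ∧ k ≠ j} = ((Finset.univ.erase i).erase j).card := by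
    rw [Fintype.card_subtype]
    congr 1
    ext k
    simp [and_comm]
  have h2 := Finset.card_pos.2 ⟨j, Finset.mem_erase.2 ⟨hij.symm, Finset.mem_univ j⟩⟩
  have h3 := Finset.card_erase_of_mem (Finset.mem_erase.2 ⟨hij.symm, Finset.mem_univ j⟩)
  have h4 := Finset.card_erase_add_one (Finset.mem_univ i)
  rw [Finset.card_univ] at h4
  rw [Fintype.card_sum, Fintype.card_fin, h1, h3]
  omega

theorem sum_mergeLengths (n : ι → ℕ) {i j : ι} (hij : i ≠ j) :
    ∑ k, mergeLengths n i j (n i + n j + 2) k = ∑ k, n k + 2 := by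
  rw [Fintype.sum_sum_type]
  have h1 : ∑ k : {k // k ≠ i ∧ k ≠ j}, mergeLengths n i j (n i + n j + 2) (Sum.inr k) =
      ∑ k ∈ (Finset.univ.erase i).erase j, n k :=
    (Finset.sum_subtype _ (fun k => by simp [and_comm]) n).symm
  rw [h1, ← Finset.add_sum_erase _ n (Finset.mem_univ i),
    ← Finset.add_sum_erase _ n (Finset.mem_erase.2 ⟨hij.symm, Finset.mem_univ j⟩)]
  simp [mergeLengths]
  ring

theorem sum_splitLengths (n : ι → ℕ) (i : ι) {x : ℕ} (hx : x ≤ n i + 1) :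
    ∑ k, splitLengths n i (n i + 2 - x) x k = ∑ k, n k + 2 := by
  rw [Fintype.sum_sum_type]
  have h1 : ∑ k : {k // k ≠ i}, splitLengths n i (n i + 2 - x) x (Sum.inr k) =
      ∑ k ∈ Finset.univ.erase i, n k :=
    (Finset.sum_subtype _ (fun k => by simp) n).symm
  rw [h1, ← Finset.add_sum_erase _ n (Finset.mem_univ i)]
  simp [splitLengths]
  omega

theorem sum_erase_eq_two_mul_sum_Ioi {L : ℕ} (f : Fin L → Fin L → ℚ) (hf : ∀ i j, f i j = f j i) :
    ∑ i, ∑ j ∈ Finset.univ.erase i, f i j = 2 * ∑ i, ∑ j ∈ Finset.Ioi i, f i j := by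
  have h1 : ∀ i : Fin L, ∑ j ∈ Finset.univ.erase i, f i j =
      ∑ j ∈ Finset.Ioi i, f i j + ∑ j ∈ Finset.Iio i, f i j := by
    intro i
    rw [← Finset.sum_union]
    · congr 1
      ext j
      simp only [Finset.mem_erase, Finset.mem_univ, and_true, Finset.mem_union, Finset.mem_Ioi,
        Finset.mem_Iio, ne_eq]
      rw [or_comm]
      exact ne_iff_lt_or_gt
    · rw [Finset.disjoint_left]
      intro j h2 h3
      exact lt_asymm (Finset.mem_Ioi.1 h2) (Finset.mem_Iio.1 h3)
  have h2 : ∑ i, ∑ j ∈ Finset.Iio i, f i j = ∑ i, ∑ j ∈ Finset.Ioi i, f i j := by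
    rw [Finset.sum_comm' (t' := Finset.univ) (s' := fun j => Finset.Ioi j)
      (by intro i j; simp)]
    exact Finset.sum_congr rfl fun i _ => Finset.sum_congr rfl fun j _ => hf j i
  rw [Finset.sum_congr rfl fun i _ => h1 i, Finset.sum_add_distrib, h2]
  ring

theorem rescaledNumGluings_mergeLengths {N m : ℕ} (n : ι → ℕ) {i j : ι} (hij : i ≠ j) (g : ℤ)
    (hm : ((m + 1 : ℕ) : ℤ) + 1 = Fintype.card ι + 2 * g) (hN : N = ∑ i, n i + 2 * (m + 1)) :
    rescaledNumGluings g (mergeLengths n i j (n i + n j + 2)) * numRelabellings N m =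
      labelledCount N m (mergeLengths n i j (n i + n j + 2)) := by
  have h1 := card_mergeLengths_index hij
  refine rescaledNumGluings_mul g (by omega) ?_ ⟨Sum.inl 0, Nat.succ_pos _⟩
  rw [sum_mergeLengths n hij, hN]
  ring

theorem rescaledNumGluings_splitLengths {N m : ℕ} (n : ι → ℕ) (i : ι) {x : ℕ}
    (hx : x ∈ Finset.Icc 1 (n i + 1)) (g : ℤ)
    (hm : ((m + 1 : ℕ) : ℤ) + 1 = Fintype.card ι + 2 * g) (hN : N = ∑ i, n i + 2 * (m + 1)) :
    rescaledNumGluings (g - 1) (splitLengths n i (n i + 2 - x) x) * numRelabellings N m =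
      labelledCount N m (splitLengths n i (n i + 2 - x) x) := by
  rw [Finset.mem_Icc] at hx
  have h1 : Fintype.card (Fin 2 ⊕ {k // k ≠ i}) = Fintype.card ι + 1 := by
    have := Fintype.card_pos_iff.2 ⟨i⟩
    rw [Fintype.card_sum, Fintype.card_fin, Fintype.card_subtype_compl, Fintype.card_subtype_eq]
    omega
  refine rescaledNumGluings_mul (g - 1) (by omega) ?_ ⟨Sum.inl 1, hx.1⟩
  rw [sum_splitLengths n i hx.2, hN]
  ring

/-- One fewer pair and two more unglued edges leave `N` unchanged, so every term on the right
carries the same factor `numRelabellings N m`, and the left side carries `2 * (m + 1)` times it. -/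
theorem rescaledNumGluings_recursion {L m : ℕ} (g : ℤ) (n : Fin L → ℕ)
    (hm : ((m + 1 : ℕ) : ℤ) + 1 = L + 2 * g) (hpos : ∃ i, 0 < n i) :
    ((m + 1 : ℕ) : ℚ) * rescaledNumGluings g n =
      (∑ i : Fin L, ∑ j ∈ Finset.Ioi i, (tilde (n i) : ℚ) * (tilde (n j) : ℚ) *
        rescaledNumGluings g (mergeLengths n i j (n i + n j + 2))) +
      (1 / 2 : ℚ) * ∑ i : Fin L, (tilde (n i) : ℚ) * ∑ x ∈ Finset.Icc 1 (n i + 1),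
        rescaledNumGluings (g - 1) (splitLengths n i (n i + 2 - x) x) := by
  obtain ⟨N, hN⟩ : ∃ N, N = ∑ i, n i + 2 * (m + 1) := ⟨_, rfl⟩
  have hm' : ((m + 1 : ℕ) : ℤ) + 1 = Fintype.card (Fin L) + 2 * g := by rwa [Fintype.card_fin]
  have hK : (numRelabellings N m : ℚ) ≠ 0 := Nat.cast_ne_zero.2 (numRelabellings_pos N m).ne'
  have h1 := rescaledNumGluings_mul g hm' hN hpos
  have h2 := labelledCount_succ N m n hpos
  simp only [mul_add, Finset.sum_add_distrib, Finset.mul_sum] at h2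
  rw [sum_erase_eq_two_mul_sum_Ioi (fun i j => (tilde (n i) : ℚ) *
    ((tilde (n j) : ℚ) * labelledCount N m (mergeLengths n i j (n i + n j + 2)))) ?_] at h2
  · rw [numRelabellings_succ, h2] at h1
    refine mul_right_cancel₀ hK (mul_left_cancel₀ (two_ne_zero (α := ℚ)) ?_)
    calc _ = rescaledNumGluings g n * ((2 * (m + 1) * numRelabellings N m : ℕ) : ℚ) := by
          push_cast; ring
      _ = _ := by
          rw [h1, add_mul, mul_add, mul_right_comm (1 / 2 : ℚ), ← mul_assoc 2, ← mul_assoc 2]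
          simp only [Finset.sum_mul, Finset.mul_sum]
          congr 1
          · refine Finset.sum_congr rfl fun i _ => Finset.sum_congr rfl fun j hj => ?_
            rw [← rescaledNumGluings_mergeLengths n (Finset.mem_Ioi.1 hj).ne g hm' hN]
            ring
          · refine Finset.sum_congr rfl fun i _ => Finset.sum_congr rfl fun x hx => ?_
            rw [← rescaledNumGluings_splitLengths n i hx g hm' hN]
            ring
  · intro i j
    rw [labelledCount_mergeLengths_comm N m n i j, add_comm (n i)]
    ring

end BoundaryRecursion
end PolygonGluing

theorem mainTheorem4 (g L : ℕ) (n : Fin L → ℕ)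
    (hzero : ∃ i, n i = 0) (hpos : ∃ i, 0 < n i) :
    ((L : ℚ) + 2 * (g : ℚ) - 1) * PolygonGluing.rescaledNumGluings (g : ℤ) n =
      (∑ i : Fin L, ∑ j ∈ Finset.Ioi i,
        (PolygonGluing.tilde (n i) : ℚ) * (PolygonGluing.tilde (n j) : ℚ) *
          PolygonGluing.rescaledNumGluings (g : ℤ)
            (Sum.elim ![n i + n j + 2] (fun k : {k : Fin L // k ≠ i ∧ k ≠ j} => n k))) +
      (1 / 2 : ℚ) * ∑ i : Fin L, (PolygonGluing.tilde (n i) : ℚ) *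
        ∑ x ∈ Finset.Icc 1 (n i + 1),
          PolygonGluing.rescaledNumGluings ((g : ℤ) - 1)
            (Sum.elim ![n i + 2 - x, x] (fun k : {k : Fin L // k ≠ i} => n k)) := by
  -- A zero and a positive entry give two boundaries, so there is at least one glued pair to unglue,
  -- and `m = L + 2 * g - 2` is a genuine subtraction.
  have hL : 2 ≤ L := by
    obtain ⟨i, hi⟩ := hzero
    obtain ⟨j, hj⟩ := hpos
    have hij : i ≠ j := by rintro rfl; omega
    by_contra hL
    exact hij (Fin.ext (by omega))
  have hm : (L : ℚ) + 2 * (g : ℚ) - 1 = ((L + 2 * g - 2 + 1 : ℕ) : ℚ) := by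
    rw [show L + 2 * g - 2 + 1 = L + 2 * g - 1 by omega, Nat.cast_sub (by omega)]
    push_cast
    ring
  rw [hm]
  exact PolygonGluing.rescaledNumGluings_recursion (g : ℤ) n (by omega) hpos
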